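/- Lie groups are modelled on Hausdorff locally convex spaces over $\mathbb K\in\{\mathbb R,\mathbb C\}$, with smoothness in the Michal--Bastiani sense ($C^k$ maps with continuous iterated directional derivatives). Let $G$ and $N$ be Lie groups, and suppose that the center $Z(N)$ is a split Lie subgroup of $N$: $Z(N)$ is a Lie group, $N_{\rm ad}:=N/Z(N)$ is a manifold, and the inclusion $Z(N)\to N$ and the quotient map $q_N\colon N\to N_{\rm ad}$ are smooth and make $N$ a smooth principal $Z(N)$-bundle over $N_{\rm ad}$. Let $S\colon G\to \operatorname{Aut}(N)$ be a smooth action of $G$ on $N$ by automorphisms (that is, a homomorphism for which $(g,n)\mapsto S(g)(n)$ is smooth), and let $\overline S$ be the induced action on $N_{\rm ad}$. **Notation.** For a Lie group $A$, $C^1_s(G,A)$ is the set of maps $f\colon G\to A$ with $f(1)=1$ that are smooth in a neighborhood of $1$. $C^2_{ss}(G,A)$ is the set of maps $\omega\colon G\times G\to A$ with $\omega(g,1)=\omega(1,g)=1$ that are smooth in a neighborhood of $(1,1)$ and for which, for each $g\in G$, the map $x\mapsto \omega(g,x)\,\omega(gxg^{-1},g)^{-1}$ is smooth in a neighborhood of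 $1$. For an action $T$ of $G$ on $A$ by automorphisms and $f\colon G\to A$, put $(d_Tf)(g,g')=f(g)\,T(g)(f(g'))\,f(gg')^{-1}$. Let $Z^1_s(G,A)_T=\{f\in C^1_s(G,A): d_Tf=1\}$, and let $H^1_s(G,A)_T$ be the pointed set of orbits in $Z^1_s(G,A)_T$ of the action $(n.f)(g)=n f(g)\,T(g)(n)^{-1}$ of $A$, pointed by the class of the constant cocycle $1$. Let $Z^1_s(G,N,Z(N))_S=\{f\in C^1_s(G,N): \operatorname{im}(d_Sf)\subseteq Z(N)\}$. The set $H^1_s(G,Z(N))_S$ is an abelian group, and so is $H^2_{ss}(G,Z(N))_S=Z^2_{ss}(G,Z(N))_S/d_S\big(C^1_s(G,Z(N))\big)$, where $Z^2_{ss}(G,Z(N))_S$ is the group of $2$-cocycles in $C^2_{ss}(G,Z(N))$ with respect to the action $S$ on $Z(N)$. Both groups have their usual structure by pointwise multiplication. A superscript $G$ denotes $G$-fixed points. $\operatorname{Ext}(G,N)$ is the set of equivalence classes of Lie group extensions $1\to N\xrightarrow{\iota}\widehat G\xrightarrow{q} G\to 1$ (short exact sequences of Lie groups for which $\widehat G$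 is a smooth principal $N$-bundle over $G$), where two extensions are equivalent if there is a morphism of Lie groups between them inducing the identity on $N$ and on $G$. A section $\sigma\in C^1_s(G,\widehat G)$ of $q$ has the factor system $(T,\omega)$ if $\sigma(g)\iota(n)\sigma(g)^{-1}=\iota(T(g)(n))$ and $\sigma(g)\sigma(g')\sigma(gg')^{-1}=\iota(\omega(g,g'))$; the extension is then denoted $N\times_{(T,\omega)}G$. $\operatorname{Ext}(G,N)_{[S]}$ is the set of classes of extensions having a factor system $(T,\omega)$ with $T(g)(n)=h(g)\,S(g)(n)\,h(g)^{-1}$ for some $h\in C^1_s(G,N)$. The subset $\operatorname{Ext}(G,N)_{[S],{\rm split}}$ consists of the classes in it of extensions for which $q$ has a section that is a morphism of Lie groups. The group $H^2_{ss}(G,Z(N))_S$ acts on $\operatorname{Ext}(G,N)_{[S]}$ by $[\beta].[N\times_{(S,\omega)}G]=[N\times_{(S,\omega\beta)}G]$. **Statement.** $N_{\rm ad}$ is a Lie group and $\overline S$ is a smooth action on it. There is an exact sequence of groups (for the first four terms), resp. pointed sets, $$Z(N)^G\hookrightarrow N^G\to N_{\rm ad}^G\xrightarrow{\ \delta_0\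 } H^1_s(G,Z(N))_S\to H^1_s(G,N)_S\to H^1_s(G,N_{\rm ad})_{\overline S}\xrightarrow{\ \delta\ }H^2_{ss}(G,Z(N))_S .$$ Here the unlabelled maps are induced by the inclusion $Z(N)\to N$ and by $q_N$, and $\delta_0(q_N(n))$ is the class of $g\mapsto n^{-1}S(g)(n)$. Every $f\in Z^1_s(G,N_{\rm ad})_{\overline S}$ can be written as $f=q_N\circ\widehat f$ with $\widehat f\in Z^1_s(G,N,Z(N))_S$, and $\delta([f])=[d_S\widehat f]$ for each such $\widehat f$. Moreover, in additive notation for $H^2_{ss}(G,Z(N))_S$, $$\operatorname{Ext}(G,N)_{[S],{\rm split}}=-\operatorname{im}(\delta).[N\rtimes_S G].$$ -/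

import Mathlib

open Set Filter Topology
open scoped IsMulCommutative

universe u v w

/-! ## Differential calculus in locally convex spaces -/

/-- A Hausdorff locally convex topological vector space over `𝕜` (`ℝ` or `ℂ`): a topological vector
space whose topology is defined by seminorms. -/
class LCSpace (𝕜 : Type*) (E : Type*) [RCLike 𝕜] [AddCommGroup E] [Module 𝕜 E]
    [TopologicalSpace E] : Prop
    extends IsTopologicalAddGroup E, ContinuousSMul 𝕜 E, PolynormableSpace 𝕜 E, T2Space E

/-- `IsCk 𝕜 k f U`: the map `f` is `C^k` on the open set `U`, in the sense that `f` is continuous,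
the directional derivatives `df (x, h) = lim_{t → 0} t⁻¹ (f (x + t h) - f x)` exist for all `x ∈ U`
and all `h`, and `df` is a `C^{k-1}` map on `U × E` (in particular continuous). -/
def IsCk (𝕜 : Type*) [RCLike 𝕜] {F : Type v} [AddCommGroup F] [Module 𝕜 F] [TopologicalSpace F] :
    ℕ → ∀ {E : Type u} [AddCommGroup E] [Module 𝕜 E] [TopologicalSpace E], (E → F) → Set E → Prop
  | 0, _, _, _, _, f, U => ContinuousOn f U
  | k + 1, E, _, _, _, f, U => ContinuousOn f U ∧ ∃ df : E × E → F,
      (∀ x ∈ U, ∀ h : E,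
        Tendsto (fun t : 𝕜 => t⁻¹ • (f (x + t • h) - f x)) (𝓝[≠] 0) (𝓝 (df (x, h)))) ∧
      IsCk 𝕜 k df (U ×ˢ (univ : Set E))

/-- Smooth (`C^∞`) maps on an open subset of a locally convex space. -/
def IsCInf (𝕜 : Type*) [RCLike 𝕜] {E : Type u} {F : Type v} [AddCommGroup E] [Module 𝕜 E]
    [TopologicalSpace E] [AddCommGroup F] [Module 𝕜 F] [TopologicalSpace F]
    (f : E → F) (U : Set E) : Prop :=
  ∀ k : ℕ, IsCk 𝕜 k f U

section Calculus

variable {𝕜 : Type*} [RCLike 𝕜]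
variable {E : Type u} [AddCommGroup E] [Module 𝕜 E] [TopologicalSpace E]
variable {F : Type v} [AddCommGroup F] [Module 𝕜 F] [TopologicalSpace F]
variable {H : Type w} [AddCommGroup H] [Module 𝕜 H] [TopologicalSpace H]

instance LCSpace.instProd [LCSpace 𝕜 E] [LCSpace 𝕜 F] : LCSpace 𝕜 (E × F) where

theorem IsCk.continuousOn {k : ℕ} {f : E → F} {U : Set E} (h : IsCk 𝕜 k f U) :
    ContinuousOn f U := by
  cases k with
  | zero => exact h
  | succ k => exact h.1

theorem IsCk.mono {k : ℕ} {E : Type u} [AddCommGroup E] [Module 𝕜 E] [TopologicalSpace E]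
    {f : E → F} {U V : Set E} (h : IsCk 𝕜 k f U) (hV : V ⊆ U) : IsCk 𝕜 k f V := by
  induction k generalizing E with
  | zero => exact ContinuousOn.mono h hV
  | succ k ih =>
    obtain ⟨h1, df, h2, h3⟩ := h
    exact ⟨h1.mono hV, df, fun x hx => h2 x (hV hx), ih h3 (prod_mono hV Subset.rfl)⟩

theorem IsCk.of_succ {k : ℕ} {E : Type u} [AddCommGroup E] [Module 𝕜 E] [TopologicalSpace E]
    {f : E → F} {U : Set E} (h : IsCk 𝕜 (k + 1) f U) : IsCk 𝕜 k f U := by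
  induction k generalizing E with
  | zero => exact h.1
  | succ k ih =>
    obtain ⟨h1, df, h2, h3⟩ := h
    exact ⟨h1, df, h2, ih h3⟩

theorem tendsto_line [IsTopologicalAddGroup E] [ContinuousSMul 𝕜 E] (x h : E) :
    Tendsto (fun t : 𝕜 => x + t • h) (𝓝[≠] 0) (𝓝 x) := by
  have : Continuous (fun t : 𝕜 => x + t • h) := by fun_prop
  have h2 := this.tendsto 0
  simp only [zero_smul, add_zero] at h2
  exact h2.mono_left nhdsWithin_le_nhds

theorem IsCk.congr [LCSpace 𝕜 E] {k : ℕ} {f g : E → F} {U : Set E} (h : IsCk 𝕜 k f U)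
    (hU : IsOpen U) (hfg : EqOn g f U) : IsCk 𝕜 k g U := by
  cases k with
  | zero => exact ContinuousOn.congr h hfg
  | succ k =>
    obtain ⟨h1, df, h2, h3⟩ := h
    refine ⟨h1.congr hfg, df, fun x hx y => (h2 x hx y).congr' ?_, h3⟩
    filter_upwards [tendsto_line (𝕜 := 𝕜) x y (hU.mem_nhds hx)] with t ht
    rw [hfg hx, hfg ht]

theorem IsCk.of_local [T2Space F] {k : ℕ} {E : Type u} [AddCommGroup E] [Module 𝕜 E]
    [TopologicalSpace E] [LCSpace 𝕜 E] {f : E → F} {U : Set E} (hU : IsOpen U)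
    (h : ∀ x ∈ U, ∃ V : Set E, IsOpen V ∧ x ∈ V ∧ IsCk 𝕜 k f V) : IsCk 𝕜 k f U := by
  induction k generalizing E with
  | zero =>
    intro x hx
    obtain ⟨V, hV, hxV, hf⟩ := h x hx
    exact (ContinuousOn.continuousAt hf (hV.mem_nhds hxV)).continuousWithinAt
  | succ k ih =>
    have hc : ContinuousOn f U := by
      intro x hx
      obtain ⟨V, hV, hxV, hf⟩ := h x hx
      exact (hf.1.continuousAt (hV.mem_nhds hxV)).continuousWithinAt
    have h' : ∀ x : E, ∃ y : E × E → F, x ∈ U → ∀ h : E,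
        Tendsto (fun t : 𝕜 => t⁻¹ • (f (x + t • h) - f x)) (𝓝[≠] 0) (𝓝 (y (x, h))) := by
      intro x
      by_cases hx : x ∈ U
      · obtain ⟨V, hV, hxV, hf, df, hd, -⟩ := h x hx
        exact ⟨df, fun _ => hd x hxV⟩
      · exact ⟨fun _ => 0, fun h => absurd h hx⟩
    choose d hd using h'
    refine ⟨hc, fun p => d p.1 p, fun x hx y => hd x hx y, ih (hU.prod isOpen_univ) ?_⟩
    rintro ⟨x, y⟩ ⟨hx, -⟩
    obtain ⟨V, hV, hxV, hf, df, hdf, hk⟩ := h x hx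
    have hUV : IsOpen ((U ∩ V) ×ˢ (univ : Set E)) := (hU.inter hV).prod isOpen_univ
    refine ⟨_, hUV, ⟨⟨hx, hxV⟩, trivial⟩,
      (hk.mono (prod_mono inter_subset_right Subset.rfl)).congr hUV ?_⟩
    rintro ⟨a, b⟩ ⟨⟨haU, haV⟩, -⟩
    exact tendsto_nhds_unique (hd a haU b) (hdf a haV b)

theorem IsCk.prodMk {k : ℕ} {E : Type u} [AddCommGroup E] [Module 𝕜 E] [TopologicalSpace E]
    {f : E → F} {g : E → H} {U : Set E} (hf : IsCk 𝕜 k f U) (hg : IsCk 𝕜 k g U) :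
    IsCk 𝕜 k (fun x => (f x, g x)) U := by
  induction k generalizing E with
  | zero => exact ContinuousOn.prodMk hf hg
  | succ k ih =>
    obtain ⟨h1, df, h2, h3⟩ := hf
    obtain ⟨h1', dg, h2', h3'⟩ := hg
    exact ⟨h1.prodMk h1', fun p => (df p, dg p),
      fun x hx y => (h2 x hx y).prodMk_nhds (h2' x hx y), ih h3 h3'⟩

theorem isCk_const [LCSpace 𝕜 F] (k : ℕ) {E : Type u} [AddCommGroup E] [Module 𝕜 E]
    [TopologicalSpace E] (c : F) (U : Set E) : IsCk 𝕜 k (fun _ : E => c) U := by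
  induction k generalizing E c with
  | zero => exact continuousOn_const
  | succ k ih =>
    refine ⟨continuousOn_const, fun _ => 0, fun x _ y => ?_, ih 0 _⟩
    simp

theorem isCk_clm [LCSpace 𝕜 F] (k : ℕ) {E : Type u} [AddCommGroup E] [Module 𝕜 E]
    [TopologicalSpace E] (L : E →L[𝕜] F) (U : Set E) : IsCk 𝕜 k L U := by
  induction k generalizing E with
  | zero => exact L.continuous.continuousOn
  | succ k ih =>
    refine ⟨L.continuous.continuousOn, fun p => L p.2, fun x _ y => ?_,
      ih (L.comp (ContinuousLinearMap.snd 𝕜 E E)) _⟩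
    refine tendsto_const_nhds.congr' ?_
    filter_upwards [self_mem_nhdsWithin] with t ht
    have ht' : t ≠ 0 := ht
    simp [smul_smul, inv_mul_cancel₀ ht']

theorem IsCk.comp_clm {k : ℕ} {E : Type u} [AddCommGroup E] [Module 𝕜 E] [TopologicalSpace E]
    {E' : Type w} [AddCommGroup E'] [Module 𝕜 E'] [TopologicalSpace E'] {f : E → F} {U : Set E}
    (hf : IsCk 𝕜 k f U) (L : E' →L[𝕜] E) {U' : Set E'} (hm : MapsTo L U' U) :
    IsCk 𝕜 k (fun x => f (L x)) U' := by
  induction k generalizing E E' with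
  | zero => exact ContinuousOn.comp hf L.continuous.continuousOn hm
  | succ k ih =>
    obtain ⟨h1, df, h2, h3⟩ := hf
    refine ⟨h1.comp L.continuous.continuousOn hm, fun p => df (L p.1, L p.2), fun x hx y => ?_,
      ih h3 (L.prodMap L) fun p hp => ⟨hm hp.1, trivial⟩⟩
    simpa using h2 (L x) (hm hx) (L y)

theorem exists_dual_of_seminorm {E : Type u} [AddCommGroup E] [Module 𝕜 E]
    (p : Seminorm 𝕜 E) (x : E) :
    ∃ g : E →ₗ[𝕜] 𝕜, g x = (p x : 𝕜) ∧ ∀ y, ‖g y‖ ≤ p y := by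
  let _ : SeminormedAddCommGroup E := p.toSeminormedAddCommGroup
  let _ : NormedSpace 𝕜 E := ⟨fun a b => (map_smul_eq_mul p a b).le⟩
  obtain ⟨g, hg, hgx⟩ := exists_dual_vector'' 𝕜 x
  refine ⟨g, hgx, fun y => ?_⟩
  have h1 := g.le_opNorm y
  have h2 : ‖g‖ * ‖y‖ ≤ 1 * ‖y‖ := mul_le_mul_of_nonneg_right hg (norm_nonneg y)
  rw [one_mul] at h2
  exact h1.trans h2

/-- Directional difference quotients of a `C^1` map along a varying direction. -/
theorem tendsto_quotient_of_tendsto [LCSpace 𝕜 E] [LCSpace 𝕜 F] {g : E → F} {V : Set E}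
    (hV : IsOpen V) {dg : E × E → F}
    (hd : ∀ x ∈ V, ∀ h : E,
      Tendsto (fun t : 𝕜 => t⁻¹ • (g (x + t • h) - g x)) (𝓝[≠] 0) (𝓝 (dg (x, h))))
    (hc : ContinuousOn dg (V ×ˢ (univ : Set E))) {y : E} (hy : y ∈ V) {c : 𝕜 → E} {h : E}
    (hch : Tendsto c (𝓝[≠] 0) (𝓝 h)) :
    Tendsto (fun t : 𝕜 => t⁻¹ • (g (y + t • c t) - g y)) (𝓝[≠] 0) (𝓝 (dg (y, h))) := by
  have hWS := PolynormableSpace.withSeminorms 𝕜 F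
  rw [hWS.tendsto_nhds]
  rintro ⟨p, hp⟩ ε hε
  change ∀ᶠ t in 𝓝[≠] 0, p (t⁻¹ • (g (y + t • c t) - g y) - dg (y, h)) < ε
  have hW : {z : E × E | z.1 ∈ V ∧ p (dg z - dg (y, h)) < ε / 2} ∈ 𝓝 (y, h) := by
    have h1 : ContinuousAt dg (y, h) :=
      hc.continuousAt ((hV.prod isOpen_univ).mem_nhds ⟨hy, trivial⟩)
    have h2 : Tendsto (fun z => p (dg z - dg (y, h))) (𝓝 (y, h)) (𝓝 (p 0)) := by
      refine (hp.tendsto 0).comp ?_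
      have := Tendsto.sub h1 (tendsto_const_nhds (x := dg (y, h)))
      rwa [sub_self] at this
    rw [map_zero] at h2
    filter_upwards [h2.eventually_lt_const (half_pos hε),
      continuous_fst.continuousAt.preimage_mem_nhds (hV.mem_nhds hy)] with z h3 h4
    exact ⟨h4, h3⟩
  have hΦ : Continuous (fun q : (𝕜 × E) × ℝ => (y + ((q.2 : 𝕜) * q.1.1) • q.1.2, q.1.2)) := by
    have := RCLike.continuous_ofReal (K := 𝕜)
    fun_prop
  have hev : ∀ᶠ q : 𝕜 × E in 𝓝 (0, h), ∀ s ∈ Icc (0 : ℝ) 1,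
      (y + ((s : 𝕜) * q.1) • q.2, q.2) ∈ {z : E × E | z.1 ∈ V ∧ p (dg z - dg (y, h)) < ε / 2} := by
    refine isCompact_Icc.eventually_forall_of_forall_eventually fun s _ => ?_
    have := hΦ.tendsto ((0, h), s)
    simp only [mul_zero, zero_smul, add_zero] at this
    exact this hW
  have htc : Tendsto (fun t : 𝕜 => (t, c t)) (𝓝[≠] 0) (𝓝 (0, h)) :=
    (tendsto_id.mono_left nhdsWithin_le_nhds).prodMk_nhds hch
  filter_upwards [htc.eventually hev, self_mem_nhdsWithin] with t ht ht0
  replace ht0 : t ≠ 0 := ht0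
  obtain ⟨G, hG1, hG2⟩ := exists_dual_of_seminorm p (t⁻¹ • (g (y + t • c t) - g y) - dg (y, h))
  have hGc : Continuous G := by
    refine hWS.continuous_normedSpace_rng 𝕜 G ⟨{⟨p, hp⟩}, 1, fun x => ?_⟩
    simpa using hG2 x
  let ψ : ℝ → 𝕜 := fun s => G (t⁻¹ • g (y + ((s : 𝕜) * t) • c t)) - (s : 𝕜) * G (dg (y, h))
  have hψ : ∀ s ∈ Icc (0 : ℝ) 1, HasDerivAt ψ
      (G (dg (y + ((s : 𝕜) * t) • c t, c t)) - G (dg (y, h))) s := by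
    intro s hs
    refine HasDerivAt.sub ?_ ?_
    · rw [hasDerivAt_iff_tendsto_slope_zero]
      have h1 := hd _ (ht s hs).1 (c t)
      have h2 : Tendsto (fun r : ℝ => (r : 𝕜) * t) (𝓝[≠] 0) (𝓝[≠] 0) := by
        refine tendsto_nhdsWithin_iff.2 ⟨?_, ?_⟩
        · have : Continuous (fun r : ℝ => (r : 𝕜) * t) := by
            have := RCLike.continuous_ofReal (K := 𝕜)
            fun_prop
          have h3 := this.tendsto 0
          simp only [RCLike.ofReal_zero, zero_mul] at h3
          exact h3.mono_left nhdsWithin_le_nhds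
        · filter_upwards [self_mem_nhdsWithin] with r hr
          exact mul_ne_zero (RCLike.ofReal_ne_zero.2 hr) ht0
      refine ((hGc.tendsto _).comp (h1.comp h2)).congr' ?_
      filter_upwards [self_mem_nhdsWithin] with r hr
      have hr' : (r : 𝕜) ≠ 0 := RCLike.ofReal_ne_zero.2 hr
      simp only [Function.comp_apply, map_smul, map_sub, smul_eq_mul, RCLike.real_smul_eq_coe_mul,
        RCLike.ofReal_inv, RCLike.ofReal_add, add_mul, add_smul, add_assoc]
      field_simp
    · have h1 : HasDerivAt (fun s : ℝ => (s : 𝕜)) 1 s := by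
        simpa using (RCLike.ofRealCLM (K := 𝕜)).hasDerivAt (x := s)
      simpa using h1.mul_const (G (dg (y, h)))
  have hb : ‖ψ 1 - ψ 0‖ ≤ ε / 2 := by
    refine norm_image_sub_le_of_norm_deriv_le_segment_01'
      (fun s hs => (hψ s hs).hasDerivWithinAt) fun s hs => ?_
    rw [← map_sub]
    exact (hG2 _).trans (ht s (Ico_subset_Icc_self hs)).2.le
  have he : ψ 1 - ψ 0 = G (t⁻¹ • (g (y + t • c t) - g y) - dg (y, h)) := by
    simp only [ψ, RCLike.ofReal_one, RCLike.ofReal_zero, one_mul, zero_mul, zero_smul, add_zero,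
      map_sub, map_smul, smul_sub]
    ring
  rw [he, hG1, RCLike.norm_ofReal, abs_of_nonneg (apply_nonneg p _)] at hb
  linarith

/-- The chain rule: composites of `C^k` maps are `C^k`. -/
theorem IsCk.comp [LCSpace 𝕜 F] [LCSpace 𝕜 H] {k : ℕ} {E : Type u} [AddCommGroup E] [Module 𝕜 E]
    [TopologicalSpace E] [LCSpace 𝕜 E] {f : E → F} {g : F → H} {U : Set E} {V : Set F}
    (hU : IsOpen U) (hV : IsOpen V) (hg : IsCk 𝕜 k g V) (hf : IsCk 𝕜 k f U) (hm : MapsTo f U V) :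
    IsCk 𝕜 k (fun x => g (f x)) U := by
  induction k generalizing E F with
  | zero => exact ContinuousOn.comp hg hf hm
  | succ k ih =>
    have hfk := hf.of_succ
    obtain ⟨h1, df, h2, h3⟩ := hf
    obtain ⟨h1', dg, h2', h3'⟩ := hg
    refine ⟨h1'.comp h1 hm, fun p => dg (f p.1, df p), fun x hx y => ?_, ?_⟩
    · refine (tendsto_quotient_of_tendsto hV h2' h3'.continuousOn (hm hx) (h2 x hx y)).congr' ?_
      filter_upwards [self_mem_nhdsWithin] with t ht
      have ht' : t ≠ 0 := ht
      simp [smul_smul, mul_inv_cancel₀ ht']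
    · have hU' : IsOpen (U ×ˢ (univ : Set E)) := hU.prod isOpen_univ
      have hV' : IsOpen (V ×ˢ (univ : Set F)) := hV.prod isOpen_univ
      have hfst : IsCk 𝕜 k (fun p : E × E => f p.1) (U ×ˢ (univ : Set E)) :=
        hfk.comp_clm (ContinuousLinearMap.fst 𝕜 E E) fun p hp => hp.1
      exact ih hU' hV' h3' (hfst.prodMk h3) fun p hp => ⟨hm hp.1, trivial⟩

end Calculus

/-! ## Manifolds modelled on locally convex spaces -/

/-- A smooth (Hausdorff) manifold over `𝕜` modelled on a Hausdorff locally convex space: the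
coordinate changes of the atlas are smooth. The model space `Model` and the atlas are data. -/
class LCManifold (𝕜 : Type*) [RCLike 𝕜] (M : Type u) [TopologicalSpace M] where
  Model : Type u
  [addCommGroup : AddCommGroup Model]
  [module : Module 𝕜 Model]
  [topologicalSpace : TopologicalSpace Model]
  [lcSpace : LCSpace 𝕜 Model]
  [chartedSpace : ChartedSpace Model M]
  [t2Space : T2Space M]
  compatible : ∀ e ∈ atlas Model M, ∀ e' ∈ atlas Model M,
    IsCInf 𝕜 (fun x => e' (e.symm x)) (e.target ∩ e.symm ⁻¹' e'.source)

attribute [reducible, instance] LCManifold.addCommGroup LCManifold.module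
  LCManifold.topologicalSpace LCManifold.chartedSpace

attribute [instance] LCManifold.lcSpace

/-- `SmoothOn 𝕜 f U`: the set `U` is open, and `f` is a smooth map on `U`, that is, `f` is
continuous on `U` and smooth in all charts. -/
def SmoothOn (𝕜 : Type*) [RCLike 𝕜] {M : Type u} [TopologicalSpace M] [LCManifold 𝕜 M]
    {M' : Type v} [TopologicalSpace M'] [LCManifold 𝕜 M'] (f : M → M') (U : Set M) : Prop :=
  IsOpen U ∧ ContinuousOn f U ∧
    ∀ e ∈ atlas (LCManifold.Model 𝕜 M) M, ∀ e' ∈ atlas (LCManifold.Model 𝕜 M') M',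
      IsCInf 𝕜 (fun x => e' (f (e.symm x))) (e.target ∩ e.symm ⁻¹' (U ∩ f ⁻¹' e'.source))

/-- Smooth maps between manifolds. -/
def Smooth (𝕜 : Type*) [RCLike 𝕜] {M : Type u} [TopologicalSpace M] [LCManifold 𝕜 M]
    {M' : Type v} [TopologicalSpace M'] [LCManifold 𝕜 M'] (f : M → M') : Prop :=
  SmoothOn 𝕜 f univ

/-- `SmoothNear 𝕜 f x`: the map `f` is smooth on some open neighbourhood of `x`. -/
def SmoothNear (𝕜 : Type*) [RCLike 𝕜] {M : Type u} [TopologicalSpace M] [LCManifold 𝕜 M]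
    {M' : Type v} [TopologicalSpace M'] [LCManifold 𝕜 M'] (f : M → M') (x : M) : Prop :=
  ∃ U : Set M, x ∈ U ∧ SmoothOn 𝕜 f U

section Manifold

variable {𝕜 : Type*} [RCLike 𝕜]

theorem chart_isOpen {M : Type*} [TopologicalSpace M] {E : Type*} [TopologicalSpace E]
    {M' : Type*} [TopologicalSpace M'] (e : OpenPartialHomeomorph M E) {f : M → M'} {U : Set M}
    {s : Set M'} (hU : IsOpen U) (hf : ContinuousOn f U) (hs : IsOpen s) :
    IsOpen (e.target ∩ e.symm ⁻¹' (U ∩ f ⁻¹' s)) :=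
  e.isOpen_inter_preimage_symm (hf.isOpen_inter_preimage hU hs)

/-- The product manifold, with the products of charts as charts. -/
instance LCManifold.prod {M : Type u} [TopologicalSpace M] [LCManifold 𝕜 M]
    {M' : Type v} [TopologicalSpace M'] [LCManifold 𝕜 M'] : LCManifold 𝕜 (M × M') where
  Model := LCManifold.Model 𝕜 M × LCManifold.Model 𝕜 M'
  chartedSpace :=
    { atlas := image2 OpenPartialHomeomorph.prod (atlas (LCManifold.Model 𝕜 M) M)
        (atlas (LCManifold.Model 𝕜 M') M')
      chartAt := fun x : M × M' => (chartAt (LCManifold.Model 𝕜 M) x.1).prod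
        (chartAt (LCManifold.Model 𝕜 M') x.2)
      mem_chart_source := fun x : M × M' => ⟨mem_chart_source _ x.1, mem_chart_source _ x.2⟩
      chart_mem_atlas := fun x : M × M' =>
        mem_image2_of_mem (chart_mem_atlas _ x.1) (chart_mem_atlas _ x.2) }
  t2Space := by
    have := LCManifold.t2Space 𝕜 (M := M)
    have := LCManifold.t2Space 𝕜 (M := M')
    infer_instance
  compatible := by
    rintro _ ⟨e₁, h₁, e₂, h₂, rfl⟩ _ ⟨e₁', h₁', e₂', h₂', rfl⟩ k
    let L₁ := ContinuousLinearMap.fst 𝕜 (LCManifold.Model 𝕜 M) (LCManifold.Model 𝕜 M')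
    let L₂ := ContinuousLinearMap.snd 𝕜 (LCManifold.Model 𝕜 M) (LCManifold.Model 𝕜 M')
    exact IsCk.prodMk
      ((LCManifold.compatible e₁ h₁ e₁' h₁' k).comp_clm L₁
        fun (x : LCManifold.Model 𝕜 M × LCManifold.Model 𝕜 M') hx => ⟨hx.1.1, hx.2.1⟩)
      ((LCManifold.compatible e₂ h₂ e₂' h₂' k).comp_clm L₂
        fun (x : LCManifold.Model 𝕜 M × LCManifold.Model 𝕜 M') hx => ⟨hx.1.2, hx.2.2⟩)

variable {M : Type*} [TopologicalSpace M] [LCManifold 𝕜 M]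
variable {M₁ : Type*} [TopologicalSpace M₁] [LCManifold 𝕜 M₁]
variable {M₂ : Type*} [TopologicalSpace M₂] [LCManifold 𝕜 M₂]

theorem SmoothOn.mono {f : M → M₁} {U V : Set M} (hf : SmoothOn 𝕜 f U) (hV : IsOpen V)
    (h : V ⊆ U) : SmoothOn 𝕜 f V :=
  ⟨hV, hf.2.1.mono h, fun e he e' he' k => (hf.2.2 e he e' he' k).mono
    (inter_subset_inter_right _ (preimage_mono (inter_subset_inter_left _ h)))⟩

theorem SmoothOn.congr {f g : M → M₁} {U : Set M} (hf : SmoothOn 𝕜 f U) (h : EqOn g f U) :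
    SmoothOn 𝕜 g U := by
  have hg : ContinuousOn g U := hf.2.1.congr h
  have hs : ∀ s : Set M₁, U ∩ g ⁻¹' s = U ∩ f ⁻¹' s := fun s => by
    ext x
    exact and_congr_right fun hx => by rw [mem_preimage, mem_preimage, h hx]
  refine ⟨hf.1, hg, fun e he e' he' k => ?_⟩
  have ho := chart_isOpen e hf.1 hg e'.open_source
  rw [hs] at ho ⊢
  exact (hf.2.2 e he e' he' k).congr ho fun x hx => congrArg e' (h hx.2.1)

theorem SmoothOn.comp {f : M → M₁} {g : M₁ → M₂} {U : Set M} {V : Set M₁} (hg : SmoothOn 𝕜 g V)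
    (hf : SmoothOn 𝕜 f U) (h : MapsTo f U V) : SmoothOn 𝕜 (fun x => g (f x)) U := by
  have hc : ContinuousOn (fun x => g (f x)) U := hg.2.1.comp hf.2.1 h
  refine ⟨hf.1, hc, fun e he e'' he'' k => ?_⟩
  have hW := chart_isOpen e hf.1 hc e''.open_source
  refine IsCk.of_local hW fun x hx => ?_
  let e' := chartAt (LCManifold.Model 𝕜 M₁) (f (e.symm x))
  have hW' := chart_isOpen e hf.1 hf.2.1 e'.open_source
  have hV' := chart_isOpen e' hg.1 hg.2.1 e''.open_source
  refine ⟨_, hW'.inter hW, ⟨⟨hx.1, hx.2.1, mem_chart_source _ _⟩, hx⟩, ?_⟩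
  refine (IsCk.comp (hW'.inter hW) hV' (hg.2.2 e' (chart_mem_atlas _ _) e'' he'' k)
    ((hf.2.2 e he e' (chart_mem_atlas _ _) k).mono inter_subset_left) ?_).congr
    (hW'.inter hW) ?_
  · rintro z ⟨⟨hz1, hz2, hz3⟩, ⟨-, -, hz4⟩⟩
    refine ⟨e'.map_source hz3, ?_, ?_⟩
    · change e'.symm (e' (f (e.symm z))) ∈ V
      rw [e'.left_inv hz3]
      exact h hz2
    · change g (e'.symm (e' (f (e.symm z)))) ∈ e''.source
      rw [e'.left_inv hz3]
      exact hz4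
  · rintro z ⟨⟨hz1, hz2, hz3⟩, -⟩
    change e'' (g (f (e.symm z))) = e'' (g (e'.symm (e' (f (e.symm z)))))
    rw [e'.left_inv hz3]

theorem smoothOn_of_local {f : M → M₁} {U : Set M} (hU : IsOpen U)
    (h : ∀ x ∈ U, SmoothNear 𝕜 f x) : SmoothOn 𝕜 f U := by
  have hc : ContinuousOn f U := by
    intro x hx
    obtain ⟨V, hxV, hV, hf, -⟩ := h x hx
    exact (hf.continuousAt (hV.mem_nhds hxV)).continuousWithinAt
  refine ⟨hU, hc, fun e he e' he' k => ?_⟩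
  refine IsCk.of_local (chart_isOpen e hU hc e'.open_source) fun x hx => ?_
  obtain ⟨V, hxV, hV, hf, hk⟩ := h _ hx.2.1
  exact ⟨_, chart_isOpen e hV hf e'.open_source, ⟨hx.1, hxV, hx.2.2⟩, hk e he e' he' k⟩

theorem smooth_of_near {f : M → M₁} (h : ∀ x, SmoothNear 𝕜 f x) : Smooth 𝕜 f :=
  smoothOn_of_local isOpen_univ fun x _ => h x

theorem smooth_id : Smooth 𝕜 (fun x : M => x) := by
  refine ⟨isOpen_univ, continuousOn_id, fun e he e' he' k => ?_⟩
  have h := LCManifold.compatible e he e' he' k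
  simpa using h

theorem smooth_const (c : M₁) : Smooth 𝕜 (fun _ : M => c) :=
  ⟨isOpen_univ, continuousOn_const, fun _ _ _ _ k => isCk_const k _ _⟩

theorem smooth_fst : Smooth 𝕜 (fun x : M × M₁ => x.1) := by
  refine ⟨isOpen_univ, continuousOn_fst, ?_⟩
  rintro _ ⟨e₁, h₁, e₂, h₂, rfl⟩ e' he' k
  exact (LCManifold.compatible e₁ h₁ e' he' k).comp_clm (ContinuousLinearMap.fst 𝕜 (LCManifold.Model 𝕜 M) (LCManifold.Model 𝕜 M₁))
    fun (x : LCManifold.Model 𝕜 M × LCManifold.Model 𝕜 M₁) hx => ⟨hx.1.1, hx.2.2⟩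

theorem smooth_snd : Smooth 𝕜 (fun x : M × M₁ => x.2) := by
  refine ⟨isOpen_univ, continuousOn_snd, ?_⟩
  rintro _ ⟨e₁, h₁, e₂, h₂, rfl⟩ e' he' k
  exact (LCManifold.compatible e₂ h₂ e' he' k).comp_clm (ContinuousLinearMap.snd 𝕜 (LCManifold.Model 𝕜 M) (LCManifold.Model 𝕜 M₁))
    fun (x : LCManifold.Model 𝕜 M × LCManifold.Model 𝕜 M₁) hx => ⟨hx.1.2, hx.2.2⟩

theorem SmoothOn.prodMk {f : M → M₁} {g : M → M₂} {U : Set M} (hf : SmoothOn 𝕜 f U)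
    (hg : SmoothOn 𝕜 g U) : SmoothOn 𝕜 (fun x => (f x, g x)) U := by
  refine ⟨hf.1, hf.2.1.prodMk hg.2.1, ?_⟩
  rintro e he _ ⟨e₁, h₁, e₂, h₂, rfl⟩ k
  refine IsCk.prodMk (f := fun x => e₁ (f (e.symm x))) (g := fun x => e₂ (g (e.symm x))) ?_ ?_
  · exact (hf.2.2 e he e₁ h₁ k).mono fun x hx => ⟨hx.1, hx.2.1, hx.2.2.1⟩
  · exact (hg.2.2 e he e₂ h₂ k).mono fun x hx => ⟨hx.1, hx.2.1, hx.2.2.2⟩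

theorem Smooth.on {f : M → M₁} (hf : Smooth 𝕜 f) {U : Set M} (hU : IsOpen U) : SmoothOn 𝕜 f U :=
  SmoothOn.mono hf hU (subset_univ _)

theorem Smooth.comp_on {f : M → M₁} {g : M₁ → M₂} (hg : Smooth 𝕜 g) {U : Set M}
    (hf : SmoothOn 𝕜 f U) : SmoothOn 𝕜 (fun x => g (f x)) U :=
  SmoothOn.comp hg hf fun _ _ => trivial

theorem Smooth.comp {f : M → M₁} {g : M₁ → M₂} (hg : Smooth 𝕜 g) (hf : Smooth 𝕜 f) :
    Smooth 𝕜 (fun x => g (f x)) :=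
  hg.comp_on hf

theorem Smooth.prodMk {f : M → M₁} {g : M → M₂} (hf : Smooth 𝕜 f) (hg : Smooth 𝕜 g) :
    Smooth 𝕜 (fun x => (f x, g x)) :=
  SmoothOn.prodMk hf hg

theorem Smooth.near {f : M → M₁} (hf : Smooth 𝕜 f) (x : M) : SmoothNear 𝕜 f x :=
  ⟨univ, trivial, hf⟩

theorem SmoothNear.prodMk {f : M → M₁} {g : M → M₂} {x : M} (hf : SmoothNear 𝕜 f x)
    (hg : SmoothNear 𝕜 g x) : SmoothNear 𝕜 (fun x => (f x, g x)) x := by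
  obtain ⟨U, hxU, hU⟩ := hf
  obtain ⟨V, hxV, hV⟩ := hg
  exact ⟨U ∩ V, ⟨hxU, hxV⟩, (hU.mono (hU.1.inter hV.1) inter_subset_left).prodMk
    (hV.mono (hU.1.inter hV.1) inter_subset_right)⟩

theorem SmoothNear.comp {f : M → M₁} {g : M₁ → M₂} {x : M} (hg : SmoothNear 𝕜 g (f x))
    (hf : SmoothNear 𝕜 f x) : SmoothNear 𝕜 (fun x => g (f x)) x := by
  obtain ⟨U, hxU, hU⟩ := hf
  obtain ⟨V, hxV, hV⟩ := hg
  have hUV : IsOpen (U ∩ f ⁻¹' V) := hU.2.1.isOpen_inter_preimage hU.1 hV.1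
  exact ⟨U ∩ f ⁻¹' V, ⟨hxU, hxV⟩, hV.comp (hU.mono hUV inter_subset_left) fun y hy => hy.2⟩

theorem Smooth.comp_near {f : M → M₁} {g : M₁ → M₂} (hg : Smooth 𝕜 g) {x : M}
    (hf : SmoothNear 𝕜 f x) : SmoothNear 𝕜 (fun x => g (f x)) x :=
  (hg.near _).comp hf

end Manifold

/-! ## Lie groups, actions, and cochains -/

/-- A Lie group over `𝕜` modelled on a locally convex space: multiplication and inversion are
smooth. -/
class LCLieGroup (𝕜 : Type*) [RCLike 𝕜] (G : Type u) [TopologicalSpace G] [Group G]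
    [LCManifold 𝕜 G] : Prop where
  smooth_mul : Smooth 𝕜 (fun p : G × G => p.1 * p.2)
  smooth_inv : Smooth 𝕜 (fun g : G => g⁻¹)

/-- The sequence `H → P → B` of group homomorphisms between groups that are manifolds is short exact
and makes `P` a smooth principal `H`-bundle over `B` with respect to the right multiplication action
of `H`: both maps are smooth, and over suitable open sets `U ⊆ B` covering `B` there is a smooth
section `σ` such that `(u, h) ↦ σ u * ι h` is a diffeomorphism from `U × H` onto `q ⁻¹' U`, with
inverse `p ↦ (q p, κ p)`. -/
structure IsLieExtension (𝕜 : Type*) [RCLike 𝕜]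
    {H : Type*} [TopologicalSpace H] [Group H] [LCManifold 𝕜 H]
    {P : Type*} [TopologicalSpace P] [Group P] [LCManifold 𝕜 P]
    {B : Type*} [TopologicalSpace B] [Group B] [LCManifold 𝕜 B]
    (ι : H →* P) (q : P →* B) : Prop where
  smooth_ι : Smooth 𝕜 ι
  smooth_q : Smooth 𝕜 q
  injective : Function.Injective ι
  surjective : Function.Surjective q
  exact : q.ker = ι.range
  locally_trivial : ∀ b : B, ∃ U : Set B, b ∈ U ∧ ∃ (σ : B → P) (κ : P → H),
    SmoothOn 𝕜 σ U ∧ (∀ x ∈ U, q (σ x) = x) ∧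
    SmoothOn 𝕜 κ (q ⁻¹' U) ∧ ∀ p, q p ∈ U → p = σ (q p) * ι (κ p)

/-- The normal subgroup `H` of `P` is a split Lie subgroup: for the given Lie group structure on `H`
and the given manifold structure on `P ⧸ H`, the inclusion `H → P` is smooth and `P` is a smooth
principal `H`-bundle over `P ⧸ H` (these structures are then unique). Local triviality forces the
topologies of the Lie group `H` and the manifold `P ⧸ H` to be the subspace and quotient topology,
so these are the topologies that are used here. -/
def IsSplitLieSubgroup (𝕜 : Type*) [RCLike 𝕜] {P : Type*} [TopologicalSpace P] [Group P]
    [LCManifold 𝕜 P] (H : Subgroup P) [H.Normal] [LCManifold 𝕜 H] [LCLieGroup 𝕜 H]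
    [LCManifold 𝕜 (P ⧸ H)] : Prop :=
  IsLieExtension 𝕜 H.subtype (QuotientGroup.mk' H)

section LieGroup

variable {𝕜 : Type*} [RCLike 𝕜]
variable {M : Type*} [TopologicalSpace M] [LCManifold 𝕜 M]
variable {G : Type*} [TopologicalSpace G] [Group G] [LCManifold 𝕜 G] [LCLieGroup 𝕜 G]

theorem SmoothOn.mul {f g : M → G} {U : Set M} (hf : SmoothOn 𝕜 f U) (hg : SmoothOn 𝕜 g U) :
    SmoothOn 𝕜 (fun x => f x * g x) U :=
  (LCLieGroup.smooth_mul (𝕜 := 𝕜) (G := G)).comp_on (hf.prodMk hg)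

theorem SmoothOn.inv {f : M → G} {U : Set M} (hf : SmoothOn 𝕜 f U) :
    SmoothOn 𝕜 (fun x => (f x)⁻¹) U :=
  (LCLieGroup.smooth_inv (𝕜 := 𝕜) (G := G)).comp_on hf

theorem Smooth.mul {f g : M → G} (hf : Smooth 𝕜 f) (hg : Smooth 𝕜 g) :
    Smooth 𝕜 (fun x => f x * g x) :=
  SmoothOn.mul hf hg

theorem Smooth.inv {f : M → G} (hf : Smooth 𝕜 f) : Smooth 𝕜 (fun x => (f x)⁻¹) :=
  SmoothOn.inv hf

theorem SmoothNear.mul {f g : M → G} {x : M} (hf : SmoothNear 𝕜 f x) (hg : SmoothNear 𝕜 g x) :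
    SmoothNear 𝕜 (fun x => f x * g x) x :=
  (LCLieGroup.smooth_mul (𝕜 := 𝕜) (G := G)).comp_near (hf.prodMk hg)

theorem SmoothNear.inv {f : M → G} {x : M} (hf : SmoothNear 𝕜 f x) :
    SmoothNear 𝕜 (fun x => (f x)⁻¹) x :=
  (LCLieGroup.smooth_inv (𝕜 := 𝕜) (G := G)).comp_near hf

end LieGroup

/-- The action of the automorphisms of `N` on the centre of `N`. -/
def centerAut (N : Type*) [Group N] : MulAut N →* MulAut (Subgroup.center N) where
  toFun φ := Subgroup.centerCongr φ
  map_one' := by ext; rfl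
  map_mul' _ _ := by ext; rfl

/-- The action of the automorphisms of `N` on `N_ad = N / Z(N)`. -/
def adAut (N : Type*) [Group N] : MulAut N →* MulAut (N ⧸ Subgroup.center N) where
  toFun φ := QuotientGroup.congr (Subgroup.center N) (Subgroup.center N) φ
    (Subgroup.characteristic_iff_map_eq.1 inferInstance φ)
  map_one' := by
    ext x
    obtain ⟨n, rfl⟩ := QuotientGroup.mk_surjective x
    rfl
  map_mul' _ _ := by
    ext x
    obtain ⟨n, rfl⟩ := QuotientGroup.mk_surjective x
    rfl

/-- The subgroup `A^G` of fixed points of an action of `G` on `A` by automorphisms. -/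
def fixedPts {G A : Type*} [Group G] [Group A] (S : G →* MulAut A) : Subgroup A where
  carrier := {a | ∀ g, S g a = a}
  one_mem' g := map_one (S g)
  mul_mem' ha hb g := by rw [map_mul, ha g, hb g]
  inv_mem' ha g := by rw [map_inv, ha g]

section Cochains

variable (𝕜 : Type*) [RCLike 𝕜]
variable (G : Type*) [TopologicalSpace G] [Group G] [LCManifold 𝕜 G]
variable (A : Type*) [TopologicalSpace A] [Group A] [LCManifold 𝕜 A]

/-- `C^1_s(G, A)`: normalized maps `G → A` that are smooth in an identity neighbourhood. -/
def C1s : Set (G → A) := {f | f 1 = 1 ∧ SmoothNear 𝕜 f 1}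

/-- `C^2_s(G, A)`: normalized maps `G × G → A` that are smooth in an identity neighbourhood. -/
def C2s : Set (G × G → A) :=
  {ω | (∀ g, ω (g, 1) = 1 ∧ ω (1, g) = 1) ∧ SmoothNear 𝕜 ω (1, 1)}

/-- `C^2_ss(G, A)`: those `ω ∈ C^2_s(G, A)` for which all the maps
`ω_g : x ↦ ω(g, x) ω(g x g⁻¹, g)⁻¹` are smooth in an identity neighbourhood. -/
def C2ss : Set (G × G → A) :=
  {ω | ω ∈ C2s 𝕜 G A ∧
    ∀ g, SmoothNear 𝕜 (fun x : G => ω (g, x) * (ω (g * x * g⁻¹, g))⁻¹) 1}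

end Cochains

section Nonabelian

variable {G A : Type*} [Group G] [Group A]

/-- `(d_S f)(g, g') = f(g) S(g)(f(g')) f(g g')⁻¹` for `f : G → A`. -/
def dS (S : G →* MulAut A) (f : G → A) : G × G → A :=
  fun p => f p.1 * S p.1 (f p.2) * (f (p.1 * p.2))⁻¹

variable (𝕜 : Type*) [RCLike 𝕜] [TopologicalSpace G] [LCManifold 𝕜 G]
  [TopologicalSpace A] [LCManifold 𝕜 A]

/-- `Z^1_s(G, A)_S`: the `1`-cocycles (crossed homomorphisms) in `C^1_s(G, A)`. -/
def Z1s (S : G →* MulAut A) : Set (G → A) :=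
  {f | f ∈ C1s 𝕜 G A ∧ ∀ g g', f (g * g') = f g * S g (f g')}

/-- `Z^1_s(G, A, Z(A))_S`: the `f ∈ C^1_s(G, A)` for which `d_S f` is central. -/
def Z1sCentral (S : G →* MulAut A) : Set (G → A) :=
  {f | f ∈ C1s 𝕜 G A ∧ ∀ p, dS S f p ∈ Subgroup.center A}

/-- Two cocycles are cohomologous if they lie in the same orbit of the action
`(n.f)(g) = n f(g) S(g)(n)⁻¹` of `A`. -/
def H1s.setoid (S : G →* MulAut A) : Setoid (Z1s 𝕜 S) where
  r f f' := ∃ n : A, ∀ g, f'.1 g = n * f.1 g * (S g n)⁻¹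
  iseqv :=
    { refl := fun f => ⟨1, fun g => by simp⟩
      symm := by
        rintro f f' ⟨n, hn⟩
        refine ⟨n⁻¹, fun g => ?_⟩
        rw [hn g, map_inv]
        group
      trans := by
        rintro f f' f'' ⟨n, hn⟩ ⟨m, hm⟩
        refine ⟨m * n, fun g => ?_⟩
        rw [hm g, hn g, map_mul]
        group }

/-- The cohomology set `H^1_s(G, A)_S`, the set of `A`-orbits in `Z^1_s(G, A)_S`. -/
def H1s (S : G →* MulAut A) : Type _ := Quotient (H1s.setoid 𝕜 S)

/-- The class of a cocycle in `H^1_s(G, A)_S`. -/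
def H1s.mk (S : G →* MulAut A) (f : Z1s 𝕜 S) : H1s 𝕜 S := Quotient.mk (H1s.setoid 𝕜 S) f

/-- The base point of `H^1_s(G, A)_S`, the class of the constant cocycle `1`. -/
def H1s.base (S : G →* MulAut A) : H1s 𝕜 S :=
  H1s.mk 𝕜 S ⟨fun _ => 1, ⟨rfl, (smooth_const 1).near 1⟩, fun g g' => by simp⟩

end Nonabelian

section CenterCohomology

variable (𝕜 : Type*) [RCLike 𝕜]
variable {G : Type*} [TopologicalSpace G] [Group G] [LCManifold 𝕜 G]
variable {N : Type*} [TopologicalSpace N] [Group N] [LCManifold 𝕜 N] [LCLieGroup 𝕜 N]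

variable (G N) in
/-- `C^1_s(G, Z(N))`: the `Z(N)`-valued elements of `C^1_s(G, N)`. -/
def C1sZ : Subgroup (G → Subgroup.center N) where
  carrier := {f | (fun g => (f g : N)) ∈ C1s 𝕜 G N}
  one_mem' := ⟨rfl, (smooth_const 1).near 1⟩
  mul_mem' := by
    rintro f f' ⟨h1, h2⟩ ⟨h1', h2'⟩
    refine ⟨?_, h2.mul h2'⟩
    change (f 1 : N) * (f' 1 : N) = 1
    rw [show (f 1 : N) = 1 from h1, show (f' 1 : N) = 1 from h1', mul_one]
  inv_mem' := by
    rintro f ⟨h1, h2⟩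
    refine ⟨?_, h2.inv⟩
    change ((f 1 : N))⁻¹ = 1
    rw [show (f 1 : N) = 1 from h1, inv_one]

variable (G N) in
/-- `C^2_ss(G, Z(N))`: the `Z(N)`-valued elements of `C^2_ss(G, N)`. -/
def C2ssZ : Subgroup (G × G → Subgroup.center N) where
  carrier := {ω | (fun p => (ω p : N)) ∈ C2ss 𝕜 G N}
  one_mem' := by
    refine ⟨⟨fun g => ⟨rfl, rfl⟩, (smooth_const 1).near _⟩, fun g => ?_⟩
    have h : SmoothNear 𝕜 (fun _ : G => (1 : N) * 1⁻¹) 1 := (smooth_const _).near 1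
    exact h
  mul_mem' := by
    rintro ω ω' ⟨⟨h1, h2⟩, h3⟩ ⟨⟨h1', h2'⟩, h3'⟩
    refine ⟨⟨fun g => ⟨?_, ?_⟩, h2.mul h2'⟩, fun g => ?_⟩
    · change (ω (g, 1) : N) * (ω' (g, 1) : N) = 1
      rw [show (ω (g, 1) : N) = 1 from (h1 g).1, show (ω' (g, 1) : N) = 1 from (h1' g).1, mul_one]
    · change (ω (1, g) : N) * (ω' (1, g) : N) = 1
      rw [show (ω (1, g) : N) = 1 from (h1 g).2, show (ω' (1, g) : N) = 1 from (h1' g).2, mul_one]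
    · have h : (fun x : G => ((ω * ω') (g, x) : N) * ((ω * ω') (g * x * g⁻¹, g) : N)⁻¹) =
          fun x => ((ω (g, x) : N) * (ω (g * x * g⁻¹, g) : N)⁻¹) *
            ((ω' (g, x) : N) * (ω' (g * x * g⁻¹, g) : N)⁻¹) := by
        funext x
        have hc := Subgroup.mem_center_iff.1 (ω (g * x * g⁻¹, g))⁻¹.2
        have hc' := hc ((ω' (g, x) : N) * (ω' (g * x * g⁻¹, g) : N)⁻¹)
        simp only [Pi.mul_apply, Subgroup.coe_mul, mul_inv_rev, Subgroup.coe_inv] at hc' ⊢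
        simp only [mul_assoc] at hc' ⊢
        rw [hc']
      exact h ▸ (h3 g).mul (h3' g)
  inv_mem' := by
    rintro ω ⟨⟨h1, h2⟩, h3⟩
    refine ⟨⟨fun g => ⟨?_, ?_⟩, h2.inv⟩, fun g => ?_⟩
    · change (ω (g, 1) : N)⁻¹ = 1
      rw [show (ω (g, 1) : N) = 1 from (h1 g).1, inv_one]
    · change (ω (1, g) : N)⁻¹ = 1
      rw [show (ω (1, g) : N) = 1 from (h1 g).2, inv_one]
    · have h : (fun x : G => ((ω⁻¹) (g, x) : N) * ((ω⁻¹) (g * x * g⁻¹, g) : N)⁻¹) =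
          fun x => ((ω (g, x) : N) * (ω (g * x * g⁻¹, g) : N)⁻¹)⁻¹ := by
        funext x
        have hc := Subgroup.mem_center_iff.1 (ω (g * x * g⁻¹, g)).2 (ω (g, x) : N)⁻¹
        simp only [Pi.inv_apply, Subgroup.coe_inv, inv_inv, mul_inv_rev]
        exact hc
      exact h ▸ (h3 g).inv

/-- The differential `d_S : C^0(G, Z(N)) → C^1(G, Z(N))`, written multiplicatively. -/
def d0 (S : G →* MulAut N) : Subgroup.center N →* (G → Subgroup.center N) where
  toFun z g := centerAut N (S g) z / z
  map_one' := by funext g; simp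
  map_mul' z z' := by funext g; simp [mul_div_mul_comm]

/-- The differential `d_S : C^1(G, Z(N)) → C^2(G, Z(N))`, written multiplicatively. -/
def d1 (S : G →* MulAut N) : (G → Subgroup.center N) →* (G × G → Subgroup.center N) where
  toFun f p := centerAut N (S p.1) (f p.2) / f (p.1 * p.2) * f p.1
  map_one' := by funext p; simp
  map_mul' f f' := by
    funext p
    simp only [Pi.mul_apply, map_mul, mul_div_mul_comm, mul_mul_mul_comm]

/-- The differential `d_S : C^2(G, Z(N)) → C^3(G, Z(N))`, written multiplicatively. -/
def d2 (S : G →* MulAut N) : (G × G → Subgroup.center N) →* (G × G × G → Subgroup.center N) where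
  toFun ω p := centerAut N (S p.1) (ω (p.2.1, p.2.2)) / ω (p.1 * p.2.1, p.2.2) *
    (ω (p.1, p.2.1 * p.2.2) / ω (p.1, p.2.1))
  map_one' := by funext p; simp
  map_mul' f f' := by
    funext p
    simp only [Pi.mul_apply, map_mul, mul_div_mul_comm, mul_mul_mul_comm]

/-- `Z^1_s(G, Z(N))_S`. -/
def Z1sZ (S : G →* MulAut N) : Subgroup (G → Subgroup.center N) := C1sZ 𝕜 G N ⊓ (d1 S).ker

/-- `Z^2_ss(G, Z(N))_S`. -/
def Z2ssZ (S : G →* MulAut N) : Subgroup (G × G → Subgroup.center N) := C2ssZ 𝕜 G N ⊓ (d2 S).ker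

/-- `B^2_s(G, Z(N))_S = d_S (C^1_s(G, Z(N)))`. -/
def B2sZ (S : G →* MulAut N) : Subgroup (G × G → Subgroup.center N) := (C1sZ 𝕜 G N).map (d1 S)

/-- The group `H^1_s(G, Z(N))_S`, the quotient of the cocycles by the coboundaries
`d_S (C^0_s(G, Z(N)))`, written multiplicatively. -/
abbrev H1sZ (S : G →* MulAut N) : Type _ := Z1sZ 𝕜 S ⧸ (d0 S).range.subgroupOf (Z1sZ 𝕜 S)

/-- The group `H^2_ss(G, Z(N))_S = Z^2_ss(G, Z(N))_S / B^2_s(G, Z(N))_S`, written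
multiplicatively. -/
abbrev H2ssZ (S : G →* MulAut N) : Type _ := Z2ssZ 𝕜 S ⧸ (B2sZ 𝕜 S).subgroupOf (Z2ssZ 𝕜 S)

end CenterCohomology

/-! ## Lie group extensions -/

/-- The underlying set `N × G` of the semidirect product `N ⋊_S G`. -/
def SemiProd {G N : Type*} [Group G] [Group N] (_S : G →* MulAut N) : Type _ := N × G

namespace SemiProd

variable {𝕜 : Type*} [RCLike 𝕜]
variable {G : Type*} [TopologicalSpace G] [Group G] [LCManifold 𝕜 G]
variable {N : Type*} [TopologicalSpace N] [Group N] [LCManifold 𝕜 N]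
variable (S : G →* MulAut N)

/-- The group structure `(n, g) (n', g') = (n S(g)(n'), g g')`. -/
instance instGroup {G N : Type*} [Group G] [Group N] (S : G →* MulAut N) : Group (SemiProd S) where
  mul p p' := (p.1 * S p.2 p'.1, p.2 * p'.2)
  one := ((1 : N), (1 : G))
  inv p := (S p.2⁻¹ p.1⁻¹, p.2⁻¹)
  mul_assoc a b c := by
    refine Prod.ext ?_ (mul_assoc a.2 b.2 c.2)
    change a.1 * S a.2 b.1 * S (a.2 * b.2) c.1 = a.1 * S a.2 (b.1 * S b.2 c.1)
    rw [map_mul, map_mul, MulAut.mul_apply, mul_assoc]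
  one_mul a := by
    refine Prod.ext ?_ (one_mul a.2)
    change 1 * S 1 a.1 = a.1
    rw [map_one, MulAut.one_apply, one_mul]
  mul_one a := by
    refine Prod.ext ?_ (mul_one a.2)
    change a.1 * S a.2 1 = a.1
    rw [map_one, mul_one]
  inv_mul_cancel a := by
    refine Prod.ext ?_ (inv_mul_cancel a.2)
    change S a.2⁻¹ a.1⁻¹ * S a.2⁻¹ a.1 = 1
    rw [← map_mul, inv_mul_cancel, map_one]

/-- The product topology. -/
instance instTopologicalSpace : TopologicalSpace (SemiProd S) :=
  inferInstanceAs (TopologicalSpace (N × G))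

/-- The product manifold structure. -/
instance instLCManifold : LCManifold 𝕜 (SemiProd S) :=
  inferInstanceAs (LCManifold 𝕜 (N × G))

variable {S}

theorem lcLieGroup [LCLieGroup 𝕜 G] [LCLieGroup 𝕜 N] (hS : Smooth 𝕜 (fun p : G × N => S p.1 p.2)) :
    LCLieGroup 𝕜 (SemiProd S) where
  smooth_mul := by
    let T := (N × G) × (N × G)
    have h1 : Smooth 𝕜 (fun p : T => p.1) := smooth_fst
    have h2 : Smooth 𝕜 (fun p : T => p.2) := smooth_snd
    have h11 : Smooth 𝕜 (fun p : T => p.1.1) := smooth_fst.comp h1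
    have h12 : Smooth 𝕜 (fun p : T => p.1.2) := smooth_snd.comp h1
    have h21 : Smooth 𝕜 (fun p : T => p.2.1) := smooth_fst.comp h2
    have h22 : Smooth 𝕜 (fun p : T => p.2.2) := smooth_snd.comp h2
    exact (h11.mul (hS.comp (h12.prodMk h21))).prodMk (h12.mul h22)
  smooth_inv := by
    have h1 : Smooth 𝕜 (fun p : N × G => p.1) := smooth_fst
    have h2 : Smooth 𝕜 (fun p : N × G => p.2) := smooth_snd
    exact (hS.comp (h2.inv.prodMk h1.inv)).prodMk h2.inv

variable (S) in
/-- The inclusion `n ↦ (n, 1)`. -/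
def incl : N →* SemiProd S where
  toFun n := (n, 1)
  map_one' := rfl
  map_mul' n n' := by
    refine Prod.ext ?_ (mul_one (1 : G)).symm
    change n * n' = n * S 1 n'
    rw [map_one, MulAut.one_apply]

variable (S) in
/-- The projection `(n, g) ↦ g`. -/
def proj : SemiProd S →* G where
  toFun p := p.2
  map_one' := rfl
  map_mul' _ _ := rfl

theorem isLieExtension [LCLieGroup 𝕜 G] (hS : Smooth 𝕜 (fun p : G × N => S p.1 p.2)) :
    IsLieExtension 𝕜 (incl S) (proj S) where
  smooth_ι := smooth_id.prodMk (smooth_const 1)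
  smooth_q := by
    have h : Smooth 𝕜 (fun p : N × G => p.2) := smooth_snd
    exact h
  injective n n' h := congrArg Prod.fst h
  surjective g := ⟨((1 : N), g), rfl⟩
  exact := by
    ext p
    constructor
    · intro hp
      exact ⟨p.1, Prod.ext rfl (Eq.symm hp)⟩
    · rintro ⟨n, rfl⟩
      rfl
  locally_trivial _ := by
    refine ⟨univ, trivial, fun g => ((1 : N), g), fun p => S p.2⁻¹ p.1,
      (smooth_const 1).prodMk smooth_id, fun _ _ => rfl, ?_, ?_⟩
    · have h1 : Smooth 𝕜 (fun p : N × G => p.1) := smooth_fst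
      have h2 : Smooth 𝕜 (fun p : N × G => p.2) := smooth_snd
      exact hS.comp (h2.inv.prodMk h1)
    · rintro ⟨n, g⟩ -
      refine Prod.ext ?_ (mul_one g).symm
      change n = 1 * S g (S g⁻¹ n)
      rw [one_mul, ← MulAut.mul_apply, ← map_mul, mul_inv_cancel, map_one, MulAut.one_apply]

end SemiProd

section Extensions

/-- A Lie group extension `1 → N → Ĝ → G → 1`. -/
structure LieExt (𝕜 : Type*) [RCLike 𝕜]
    (G : Type u) [TopologicalSpace G] [Group G] [LCManifold 𝕜 G]
    (N : Type v) [TopologicalSpace N] [Group N] [LCManifold 𝕜 N] where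
  carrier : Type (max u v)
  [topologicalSpace : TopologicalSpace carrier]
  [group : Group carrier]
  [lcManifold : LCManifold 𝕜 carrier]
  [lcLieGroup : LCLieGroup 𝕜 carrier]
  ι : N →* carrier
  q : carrier →* G
  isLieExtension : IsLieExtension 𝕜 ι q

attribute [instance] LieExt.topologicalSpace LieExt.group LieExt.lcManifold LieExt.lcLieGroup

variable {𝕜 : Type*} [RCLike 𝕜]
variable {G : Type u} [TopologicalSpace G] [Group G] [LCManifold 𝕜 G]
variable {N : Type v} [TopologicalSpace N] [Group N] [LCManifold 𝕜 N] [LCLieGroup 𝕜 N]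

/-- Equivalence of extensions: there is a morphism of Lie groups between them that induces the
identity on `N` and on `G`. -/
def LieExt.Equivalent (X Y : LieExt 𝕜 G N) : Prop :=
  ∃ φ : X.carrier →* Y.carrier, Smooth 𝕜 φ ∧ (∀ n, φ (X.ι n) = Y.ι n) ∧ ∀ x, Y.q (φ x) = X.q x

theorem LieExt.Equivalent.symm {X Y : LieExt 𝕜 G N} (h : X.Equivalent Y) : Y.Equivalent X := by
  obtain ⟨φ, hφ, hι, hq⟩ := h
  have hX := X.isLieExtension
  have hY := Y.isLieExtension
  have hqι : ∀ n, Y.q (Y.ι n) = 1 := fun n => by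
    have : Y.ι n ∈ Y.q.ker := hY.exact ▸ ⟨n, rfl⟩
    exact this
  have hinj : Function.Injective φ := by
    refine (injective_iff_map_eq_one φ).2 fun x hx => ?_
    have h1 : x ∈ X.q.ker := by
      rw [MonoidHom.mem_ker, ← hq, hx, map_one]
    rw [hX.exact] at h1
    obtain ⟨n, rfl⟩ := h1
    rw [hι] at hx
    rw [hY.injective (hx.trans (map_one _).symm), map_one]
  have hsurj : Function.Surjective φ := by
    intro y
    obtain ⟨x, hx⟩ := hX.surjective (Y.q y)
    have h1 : (φ x)⁻¹ * y ∈ Y.q.ker := by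
      rw [MonoidHom.mem_ker, map_mul, map_inv, hq, hx, inv_mul_cancel]
    rw [hY.exact] at h1
    obtain ⟨n, hn⟩ := h1
    exact ⟨x * X.ι n, by rw [map_mul, hι, hn, mul_inv_cancel_left]⟩
  let ψ := MulEquiv.ofBijective φ ⟨hinj, hsurj⟩
  have hψ : ∀ y, φ (ψ.symm y) = y := fun y => ψ.apply_symm_apply y
  refine ⟨ψ.symm.toMonoidHom, smooth_of_near fun y₀ => ?_, fun n => ?_, fun y => ?_⟩
  · obtain ⟨U, hbU, σ, -, hσ, hσq, -, -⟩ := hX.locally_trivial (Y.q y₀)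
    obtain ⟨V, h1V, τ, κ, -, -, hκ, hκτ⟩ := hY.locally_trivial 1
    have hU' : IsOpen (Y.q ⁻¹' U) := by
      simpa using hY.smooth_q.2.1.isOpen_inter_preimage isOpen_univ hσ.1
    have hs : SmoothOn 𝕜 (fun y => σ (Y.q y)) (Y.q ⁻¹' U) :=
      hσ.comp (hY.smooth_q.on hU') fun y hy => hy
    have hw : SmoothOn 𝕜 (fun y => (φ (σ (Y.q y)))⁻¹ * y) (Y.q ⁻¹' U) :=
      (hφ.comp_on hs).inv.mul (smooth_id.on hU')
    have hw1 : ∀ y ∈ Y.q ⁻¹' U, Y.q ((φ (σ (Y.q y)))⁻¹ * y) = 1 := fun y hy => by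
      rw [map_mul, map_inv, hq, hσq _ hy, inv_mul_cancel]
    have hk : SmoothOn 𝕜 (fun y => κ ((φ (σ (Y.q y)))⁻¹ * y)) (Y.q ⁻¹' U) :=
      hκ.comp hw fun y hy => by
        rw [mem_preimage, hw1 y hy]
        exact h1V
    have hr : SmoothOn 𝕜 (fun y => σ (Y.q y) * X.ι ((κ 1)⁻¹ * κ ((φ (σ (Y.q y)))⁻¹ * y)))
        (Y.q ⁻¹' U) :=
      hs.mul (hX.smooth_ι.comp_on (((smooth_const (κ 1)⁻¹).on hU').mul hk))
    refine ⟨Y.q ⁻¹' U, hbU, hr.congr fun y hy => hinj ?_⟩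
    have e1 : (1 : Y.carrier) = τ 1 * Y.ι (κ 1) := by
      have := hκτ 1 (by rw [map_one]; exact h1V)
      rwa [map_one] at this
    have e2 := hκτ ((φ (σ (Y.q y)))⁻¹ * y) (by rw [hw1 y hy]; exact h1V)
    rw [hw1 y hy, eq_inv_of_mul_eq_one_left e1.symm] at e2
    rw [map_mul, hι, map_mul, map_inv, ← e2, mul_inv_cancel_left]
    exact hψ y
  · apply hinj
    exact (hψ _).trans (hι n).symm
  · rw [← hq]
    exact congrArg Y.q (hψ y)

variable (𝕜 G N) in
/-- Equivalence of extensions is an equivalence relation. -/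
def LieExt.setoid : Setoid (LieExt 𝕜 G N) where
  r := LieExt.Equivalent
  iseqv :=
    { refl := fun X => ⟨MonoidHom.id _, smooth_id, fun _ => rfl, fun _ => rfl⟩
      symm := LieExt.Equivalent.symm
      trans := by
        rintro X Y Z ⟨φ, h1, h2, h3⟩ ⟨φ', h1', h2', h3'⟩
        exact ⟨φ'.comp φ, h1'.comp h1, fun n => (congrArg φ' (h2 n)).trans (h2' n),
          fun x => (h3' _).trans (h3 x)⟩ }

variable (𝕜 G N) in
/-- `Ext(G, N)`: the set of equivalence classes of Lie group extensions of `G` by `N`. -/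
def LieExtClass : Type _ := Quotient (LieExt.setoid 𝕜 G N)

/-- The class of an extension in `Ext(G, N)`. -/
def LieExt.cls (X : LieExt 𝕜 G N) : LieExtClass 𝕜 G N := Quotient.mk (LieExt.setoid 𝕜 G N) X

/-- The extension `N ⋊_S G` of `G` by `N` defined by a smooth action `S`. -/
def LieExt.semidirect [LCLieGroup 𝕜 G] (S : G →* MulAut N)
    (hS : Smooth 𝕜 (fun p : G × N => S p.1 p.2)) : LieExt 𝕜 G N where
  carrier := SemiProd S
  lcLieGroup := SemiProd.lcLieGroup hS
  ι := SemiProd.incl S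
  q := SemiProd.proj S
  isLieExtension := SemiProd.isLieExtension hS

/-- An extension is split if the projection has a section that is a morphism of Lie groups. -/
def LieExt.Split (X : LieExt 𝕜 G N) : Prop :=
  ∃ σ : G →* X.carrier, Smooth 𝕜 σ ∧ ∀ g, X.q (σ g) = g

/-- `(T, ω)` is the factor system of the extension `X` with respect to some normalized locally
smooth section `σ`: `T(g)` is the conjugation by `σ(g)` and `ω(g, g') = σ(g) σ(g') σ(g g')⁻¹`.
Equivalently, `X` is equivalent to the extension `N ×_(T, ω) G`, the set `N × G` with the
multiplication `(n, g) (n', g') = (n T(g)(n') ω(g, g'), g g')`. -/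
def LieExt.HasFactorSystem (X : LieExt 𝕜 G N) (T : G → MulAut N) (ω : G × G → N) : Prop :=
  ∃ σ : G → X.carrier, σ ∈ C1s 𝕜 G X.carrier ∧ (∀ g, X.q (σ g) = g) ∧
    (∀ g n, σ g * X.ι n * (σ g)⁻¹ = X.ι (T g n)) ∧
    ∀ g g', σ g * σ g' * (σ (g * g'))⁻¹ = X.ι (ω (g, g'))

variable (𝕜) in
/-- The equivalence `T ∼ T'` of outer actions: `T' = (C_N ∘ h) · T` for some `h ∈ C^1_s(G, N)`. -/
def OuterEquiv (T T' : G → MulAut N) : Prop :=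
  ∃ h ∈ C1s 𝕜 G N, ∀ g, T' g = MulAut.conj (h g) * T g

variable (𝕜) in
/-- `Ext(G, N)_[S]`: the classes of extensions corresponding to the `G`-kernel `[S]`. -/
def ExtKernel (S : G → MulAut N) : Set (LieExtClass 𝕜 G N) :=
  {x | ∃ X : LieExt 𝕜 G N, X.cls = x ∧
    ∃ T ω, X.HasFactorSystem T ω ∧ OuterEquiv 𝕜 S T}

variable (𝕜) in
/-- `Ext(G, N)_{[S], split}`: the classes in `Ext(G, N)_[S]` of split extensions. -/
def ExtKernelSplit (S : G → MulAut N) : Set (LieExtClass 𝕜 G N) :=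
  {x | x ∈ ExtKernel 𝕜 S ∧ ∃ X : LieExt 𝕜 G N, X.cls = x ∧ X.Split}

/-- The action `[β].[N ×_(S, ω) G] = [N ×_(S, ω β) G]` of `H^2_ss(G, Z(N))_S` on `Ext(G, N)_[S]`,
described by its graph: `ExtAct S c x y` means `y = c.x`. -/
def ExtAct (S : G →* MulAut N) (c : H2ssZ 𝕜 S) (x y : LieExtClass 𝕜 G N) : Prop :=
  ∃ (ω : G × G → N) (β : Z2ssZ 𝕜 S) (X Y : LieExt 𝕜 G N),
    QuotientGroup.mk β = c ∧ X.cls = x ∧ Y.cls = y ∧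
    X.HasFactorSystem S ω ∧ Y.HasFactorSystem S (fun p => ω p * (β.1 p : N))

end Extensions

/-!
Since `Z(N)` is split, `q_N` has a normalized section that is smooth near `1`. Composing it with a
cocycle `f : G → N_ad` gives a lift `f̂ : G → N`, and `d_S f̂` is central because its image in
`N_ad` is the differential of `f`. Lifts of equivalent cocycles agree up to a gauge transformation
and a central factor `z`, which changes `d_S f̂` by the coboundary `d_S z`; hence `δ` is well
defined, and `δ[f] = 1` exactly when some central factor turns `f̂` into a cocycle.

Multiplying a section of an extension by `f : G → N` twists its factor system, and all sections
arise in this way. An extension with factor system `(S, ω)` is therefore split iff some `f` makes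
the twisted cochain trivial. The twisted action `C_f · S` is then multiplicative, which says that
`d_S f` is central, and triviality of the cochain becomes `ω = (d_S f)⁻¹`. As `N ⋊_S G` has the
factor system `(S, 1)` and a factor system determines the extension up to equivalence, these are
the extensions in `-im(δ).[N ⋊_S G]`. All of them exist: twisting the semidirect product for the
action `C_f · S` by `f⁻¹` yields the factor system `(S, (d_S f)⁻¹)`.
-/

section SmoothMaps

variable {𝕜 : Type*} [RCLike 𝕜]
variable {M : Type*} [TopologicalSpace M] [LCManifold 𝕜 M]
variable {M₁ : Type*} [TopologicalSpace M₁] [LCManifold 𝕜 M₁]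
variable {M₂ : Type*} [TopologicalSpace M₂] [LCManifold 𝕜 M₂]
variable {M₃ : Type*} [TopologicalSpace M₃] [LCManifold 𝕜 M₃]

theorem SmoothNear.comp_of_eq {f : M → M₁} {g : M₁ → M₂} {x : M} {y : M₁}
    (hg : SmoothNear 𝕜 g y) (hf : SmoothNear 𝕜 f x) (hy : f x = y) :
    SmoothNear 𝕜 (fun x => g (f x)) x :=
  SmoothNear.comp (hy ▸ hg) hf

variable (𝕜) in
/-- Existence of smooth local sections of `q` through every point of the base. A local section is
encoded as a right inverse of `q` on the whole base that is smooth near the given point. -/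
def HasSmoothLocalSections (q : M → M₁) : Prop :=
  ∀ b, ∃ σ : M₁ → M, Function.RightInverse σ q ∧ SmoothNear 𝕜 σ b

theorem HasSmoothLocalSections.id : HasSmoothLocalSections 𝕜 (id : M → M) := fun b =>
  ⟨fun x => x, fun _ => rfl, smooth_id.near b⟩

theorem HasSmoothLocalSections.prodMap {q : M → M₁} {q' : M₂ → M₃}
    (hq : HasSmoothLocalSections 𝕜 q) (hq' : HasSmoothLocalSections 𝕜 q') :
    HasSmoothLocalSections 𝕜 (Prod.map q q') := by
  rintro ⟨b, b'⟩
  obtain ⟨σ, hσq, hσ⟩ := hq b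
  obtain ⟨σ', hσq', hσ'⟩ := hq' b'
  exact ⟨Prod.map σ σ', hσq.prodMap hσq',
    (hσ.comp_of_eq (smooth_fst.near _) rfl).prodMk (hσ'.comp_of_eq (smooth_snd.near _) rfl)⟩

theorem HasSmoothLocalSections.smooth_of_comp {q : M → M₁} (hq : HasSmoothLocalSections 𝕜 q)
    {f : M₁ → M₂} (hf : Smooth 𝕜 (fun x => f (q x))) : Smooth 𝕜 f := by
  refine smooth_of_near fun b => ?_
  obtain ⟨σ, hσq, hσ⟩ := hq b
  simpa only [hσq _] using hf.comp_near hσ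

end SmoothMaps

section LocallySmoothMaps

variable {𝕜 : Type*} [RCLike 𝕜]
variable {G : Type*} [TopologicalSpace G] [Group G] [LCManifold 𝕜 G]
variable {A : Type*} [TopologicalSpace A] [Group A] [LCManifold 𝕜 A]

theorem smooth_of_smoothNear_one [LCLieGroup 𝕜 G] [LCLieGroup 𝕜 A] {φ : G →* A}
    (hφ : SmoothNear 𝕜 φ 1) : Smooth 𝕜 φ := by
  refine smooth_of_near fun x => ?_
  have h : SmoothNear 𝕜 (fun y => φ x * φ (x⁻¹ * y)) x :=
    ((smooth_const (φ x)).near x).mul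
      (hφ.comp_of_eq (((smooth_const x⁻¹).mul smooth_id).near x) (inv_mul_cancel x))
  simpa only [← map_mul, mul_inv_cancel_left] using h

theorem one_mem_C1s : 1 ∈ C1s 𝕜 G A :=
  ⟨rfl, (smooth_const 1).near 1⟩

theorem inv_mem_C1s [LCLieGroup 𝕜 A] {f : G → A} (hf : f ∈ C1s 𝕜 G A) :
    f⁻¹ ∈ C1s 𝕜 G A :=
  ⟨inv_eq_one.2 hf.1, hf.2.inv⟩

theorem mul_mem_C1s [LCLieGroup 𝕜 A] {f f' : G → A} (hf : f ∈ C1s 𝕜 G A)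
    (hf' : f' ∈ C1s 𝕜 G A) : f * f' ∈ C1s 𝕜 G A :=
  ⟨by rw [Pi.mul_apply, hf.1, hf'.1, mul_one], hf.2.mul hf'.2⟩

theorem comp_mem_C1s {B : Type*} [TopologicalSpace B] [Group B] [LCManifold 𝕜 B] {φ : A → B}
    (hφ : φ ∈ C1s 𝕜 A B) {f : G → A} (hf : f ∈ C1s 𝕜 G A) : (fun g => φ (f g)) ∈ C1s 𝕜 G B :=
  ⟨(congrArg φ hf.1).trans hφ.1, hφ.2.comp_of_eq hf.2 hf.1⟩

theorem Smooth.mem_C1s {φ : G →* A} (hφ : Smooth 𝕜 φ) : ⇑φ ∈ C1s 𝕜 G A :=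
  ⟨map_one φ, hφ.near 1⟩

end LocallySmoothMaps

section SmoothActions

variable {𝕜 : Type*} [RCLike 𝕜]
variable {G : Type*} [TopologicalSpace G] [Group G] [LCManifold 𝕜 G]
variable {A : Type*} [TopologicalSpace A] [Group A] [LCManifold 𝕜 A]
variable {M : Type*} [TopologicalSpace M] [LCManifold 𝕜 M]
variable {S : G →* MulAut A}

variable (𝕜) in
/-- Smoothness of an action of `G` on `A` by automorphisms, as a map `G × A → A`. -/
def IsSmoothAction (S : G →* MulAut A) : Prop :=
  Smooth 𝕜 (fun p : G × A => S p.1 p.2)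

theorem IsSmoothAction.smoothNear_apply (hS : IsSmoothAction 𝕜 S) {g : M → G} {a : M → A} {x : M}
    (hg : SmoothNear 𝕜 g x) (ha : SmoothNear 𝕜 a x) : SmoothNear 𝕜 (fun y => S (g y) (a y)) x :=
  hS.comp_near (hg.prodMk ha)

theorem isSmoothAction_of_smoothNear_one [LCLieGroup 𝕜 G] (hS : ∀ g, Smooth 𝕜 (S g))
    (hS₁ : ∀ a, SmoothNear 𝕜 (fun p : G × A => S p.1 p.2) (1, a)) : IsSmoothAction 𝕜 S := by
  refine smooth_of_near fun ⟨g, a⟩ => ?_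
  have translate : Smooth 𝕜 (fun p : G × A => (g⁻¹ * p.1, p.2)) :=
    ((smooth_const g⁻¹).mul smooth_fst).prodMk smooth_snd
  have h : SmoothNear 𝕜 (fun p : G × A => S g (S (g⁻¹ * p.1) p.2)) (g, a) :=
    (hS g).comp_near ((hS₁ a).comp_of_eq (translate.near _) (by rw [inv_mul_cancel]))
  simpa only [← MulAut.mul_apply, ← map_mul, mul_inv_cancel_left] using h

end SmoothActions

section PrincipalBundles

variable {𝕜 : Type*} [RCLike 𝕜]
variable {H : Type*} [TopologicalSpace H] [Group H] [LCManifold 𝕜 H]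
variable {P : Type*} [TopologicalSpace P] [Group P] [LCManifold 𝕜 P]
variable {B : Type*} [TopologicalSpace B] [Group B] [LCManifold 𝕜 B]
variable {ι : H →* P} {q : P →* B}

theorem IsLieExtension.q_ι (h : IsLieExtension 𝕜 ι q) (x : H) : q (ι x) = 1 :=
  MonoidHom.mem_ker.1 (h.exact ▸ ⟨x, rfl⟩)

theorem IsLieExtension.exists_ι_eq (h : IsLieExtension 𝕜 ι q) {p : P} (hp : q p = 1) :
    ∃ x, ι x = p :=
  MonoidHom.mem_range.1 (h.exact ▸ MonoidHom.mem_ker.2 hp)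

theorem IsLieExtension.hasSmoothLocalSections (h : IsLieExtension 𝕜 ι q) :
    HasSmoothLocalSections 𝕜 q := by
  classical
  intro b
  obtain ⟨U, hbU, σ, -, hσ, hσq, -, -⟩ := h.locally_trivial b
  refine ⟨fun x => if x ∈ U then σ x else Function.surjInv h.surjective x, fun x => ?_,
    U, hbU, hσ.congr fun x hx => if_pos hx⟩
  by_cases hx : x ∈ U
  · simp only [if_pos hx, hσq x hx]
  · simp only [if_neg hx, Function.surjInv_eq]

theorem IsLieExtension.exists_section_mem_C1s [LCLieGroup 𝕜 P] (h : IsLieExtension 𝕜 ι q) :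
    ∃ σ ∈ C1s 𝕜 B P, ∀ x, q (σ x) = x := by
  obtain ⟨σ, hσq, hσ⟩ := h.hasSmoothLocalSections 1
  refine ⟨fun x => σ x * (σ 1)⁻¹, ⟨mul_inv_cancel _, hσ.mul ((smooth_const _).near 1)⟩,
    fun x => ?_⟩
  rw [map_mul, map_inv, hσq, hσq, inv_one, mul_one]

theorem IsLieExtension.lcLieGroup_base [LCLieGroup 𝕜 P] (h : IsLieExtension 𝕜 ι q) :
    LCLieGroup 𝕜 B where
  smooth_mul := by
    refine (h.hasSmoothLocalSections.prodMap h.hasSmoothLocalSections).smooth_of_comp ?_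
    simpa only [Prod.map_fst, Prod.map_snd, map_mul] using
      h.smooth_q.comp (Smooth.mul (G := P) smooth_fst smooth_snd)
  smooth_inv := by
    refine h.hasSmoothLocalSections.smooth_of_comp ?_
    simpa only [map_inv] using h.smooth_q.comp (Smooth.inv (G := P) smooth_id)

theorem IsLieExtension.smoothNear_of_ι_comp {M : Type*} [TopologicalSpace M] [LCManifold 𝕜 M]
    [LCLieGroup 𝕜 H] (h : IsLieExtension 𝕜 ι q) {f : M → H} {x : M}
    (hf : SmoothNear 𝕜 (fun y => ι (f y)) x) : SmoothNear 𝕜 f x := by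
  obtain ⟨U, h1U, σ, κ, -, -, hκ, hσκ⟩ := h.locally_trivial 1
  have hU (y : H) : ι y ∈ q ⁻¹' U := by rwa [mem_preimage, h.q_ι]
  have eq_mul_κ (y : H) : ι y = σ 1 * ι (κ (ι y)) := by
    simpa only [h.q_ι] using hσκ (ι y) (hU y)
  have eq_κ (y : H) : y = (κ (ι 1))⁻¹ * κ (ι y) := h.injective <| by
    have h₁ : 1 = σ 1 * ι (κ (ι 1)) := by rw [← eq_mul_κ, map_one]
    rw [map_mul, map_inv, ← eq_inv_of_mul_eq_one_left h₁.symm, ← eq_mul_κ]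
  have hκf : SmoothNear 𝕜 (fun y => κ (ι (f y))) x := SmoothNear.comp ⟨_, hU _, hκ⟩ hf
  simpa only [← eq_κ] using ((smooth_const (κ (ι 1))⁻¹).near x).mul hκf

theorem IsLieExtension.exists_fiberCoord [LCLieGroup 𝕜 H] [LCLieGroup 𝕜 P]
    (h : IsLieExtension 𝕜 ι q) {σ : B → P} (hσ : σ ∈ C1s 𝕜 B P) (hσq : ∀ x, q (σ x) = x) :
    ∃ ν ∈ C1s 𝕜 P H, ∀ p, ι (ν p) * σ (q p) = p := by
  have exists_fiberCoord (p : P) : ∃ x, ι x = p * (σ (q p))⁻¹ :=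
    h.exists_ι_eq (by rw [map_mul, map_inv, hσq, mul_inv_cancel])
  choose ν hν using exists_fiberCoord
  refine ⟨ν, ⟨h.injective ?_, h.smoothNear_of_ι_comp ?_⟩, fun p => ?_⟩
  · rw [hν, map_one, map_one, hσ.1, inv_one, mul_one]
  · simpa only [hν] using
      (smooth_id.near 1).mul (comp_mem_C1s hσ h.smooth_q.mem_C1s).2.inv
  · rw [hν, inv_mul_cancel_right]

theorem IsSmoothAction.ad {G : Type*} [TopologicalSpace G] [Group G] [LCManifold 𝕜 G]
    {N : Type*} [TopologicalSpace N] [Group N] [LCManifold 𝕜 N]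
    [LCManifold 𝕜 (Subgroup.center N)] [LCLieGroup 𝕜 (Subgroup.center N)]
    [LCManifold 𝕜 (N ⧸ Subgroup.center N)] (hZ : IsSplitLieSubgroup 𝕜 (Subgroup.center N))
    {S : G →* MulAut N} (hS : IsSmoothAction 𝕜 S) : IsSmoothAction 𝕜 ((adAut N).comp S) :=
  (HasSmoothLocalSections.id.prodMap
    (IsLieExtension.hasSmoothLocalSections hZ)).smooth_of_comp (hZ.smooth_q.comp hS)

end PrincipalBundles

section Conjugations

variable {N : Type*} [Group N]

theorem commute_coe_center (z : Subgroup.center N) (a : N) : Commute (z : N) a :=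
  (Subgroup.mem_center_iff.1 z.2 a).symm

theorem conj_eq_one_iff_mem_center {a : N} : MulAut.conj a = 1 ↔ a ∈ Subgroup.center N := by
  rw [Subgroup.mem_center_iff, MulEquiv.ext_iff]
  exact forall_congr' fun n => by
    rw [MulAut.conj_apply, MulAut.one_apply, mul_inv_eq_iff_eq_mul, eq_comm]

theorem mulAut_mul_conj (φ : MulAut N) (a : N) : φ * MulAut.conj a = MulAut.conj (φ a) * φ := by
  ext n
  simp

end Conjugations

section Coboundaries

variable {G N : Type*} [Group G] [Group N] (S : G →* MulAut N)

theorem dS_mul (f : G → N) (g g' : G) : dS S f (g, g') * f (g * g') = f g * S g (f g') := by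
  simp [dS]

theorem dS_eq_one_iff {f : G → N} : dS S f = 1 ↔ ∀ g g', f (g * g') = f g * S g (f g') := by
  simp only [funext_iff, Prod.forall, dS, Pi.one_apply, mul_inv_eq_one]
  exact forall₂_congr fun _ _ => eq_comm

theorem conj_dS_mul_dS (f : G → N) (a b c : G) :
    MulAut.conj (f a) (S a (dS S f (b, c))) * dS S f (a, b * c) =
      dS S f (a, b) * dS S f (a * b, c) := by
  simp [dS, mul_assoc]

/-- The action `n.f` of `N` on maps `f : G → N` whose orbits in `Z^1_s(G, N)_S` form
`H^1_s(G, N)_S`. -/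
def gaugeTransform (n : N) (f : G → N) : G → N := fun g => n * f g * (S g n)⁻¹

theorem gaugeTransform_one (f : G → N) : gaugeTransform S 1 f = f := by
  funext g
  simp [gaugeTransform]

theorem gaugeTransform_inv_eq_iff {n : N} {f f' : G → N} :
    gaugeTransform S n⁻¹ f = f' ↔ f = gaugeTransform S n f' := by
  simp only [funext_iff, gaugeTransform]
  exact forall_congr' fun g => by
    rw [map_inv, inv_inv, ← eq_mul_inv_iff_mul_eq, inv_mul_eq_iff_eq_mul, mul_assoc]

theorem gaugeTransform_inv_one (n : N) : gaugeTransform S n⁻¹ 1 = fun g => n⁻¹ * S g n := by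
  funext g
  simp [gaugeTransform]

theorem dS_gaugeTransform (n : N) (f : G → N) (p : G × G) :
    dS S (gaugeTransform S n f) p = n * dS S f p * n⁻¹ := by
  simp [dS, gaugeTransform, mul_assoc]

theorem coe_d1 (z : G → Subgroup.center N) (p : G × G) :
    (d1 S z p : N) = dS S (fun g => (z g : N)) p := by
  have h : d1 S z p = z p.1 * centerAut N (S p.1) (z p.2) * (z (p.1 * p.2))⁻¹ := by
    rw [mul_assoc, mul_comm, ← div_eq_mul_inv]
    rfl
  exact congrArg Subtype.val h

theorem coe_mul_d0 (c : G → Subgroup.center N) (z : Subgroup.center N) (g : G) :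
    ((c g * d0 S z g : Subgroup.center N) : N) =
      gaugeTransform S (z : N)⁻¹ (fun g => c g) g := by
  have hz : (d0 S z g : N) = S g z * (z : N)⁻¹ := congrArg Subtype.val (div_eq_mul_inv _ _)
  rw [Subgroup.coe_mul, hz, gaugeTransform, map_inv, inv_inv, mul_assoc _ (c g : N),
    (commute_coe_center z _).inv_left.eq, mul_assoc]

theorem dS_mul_coe (f : G → N) (z : G → Subgroup.center N) (p : G × G) :
    dS S (fun g => f g * z g) p = dS S f p * d1 S z p := by
  obtain ⟨g, g'⟩ := p
  refine mul_right_cancel (b := f (g * g') * z (g * g')) ?_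
  calc dS S (fun g => f g * z g) (g, g') * (f (g * g') * z (g * g'))
      = f g * z g * (S g (f g') * S g (z g')) := by
        rw [← map_mul]
        exact dS_mul S (fun g => f g * z g) g g'
    _ = f g * S g (f g') * (z g * S g (z g')) := (commute_coe_center _ _).mul_mul_mul_comm _ _
    _ = dS S f (g, g') * f (g * g') * (d1 S z (g, g') * z (g * g')) := by
      rw [dS_mul, coe_d1, dS_mul S fun g => (z g : N)]
    _ = dS S f (g, g') * d1 S z (g, g') * (f (g * g') * z (g * g')) :=
      ((commute_coe_center _ _).symm.mul_mul_mul_comm _ _)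

end Coboundaries

section Twisting

variable {G N : Type*} [Group N]

/-- The outer action `(C_N ∘ h) · T` by which a section `σ` inducing `T` is replaced when passing to
the section `h · σ`. -/
def twistAction (h : G → N) (T : G → MulAut N) : G → MulAut N :=
  fun g => MulAut.conj (h g) * T g

theorem twistAction_one (T : G → MulAut N) : twistAction 1 T = T := by
  funext g
  simp [twistAction]

theorem twistAction_inv_twistAction (h : G → N) (T : G → MulAut N) :
    twistAction h⁻¹ (twistAction h T) = T := by
  funext g
  simp [twistAction]

theorem twistAction_eq_self_iff {h : G → N} {T : G → MulAut N} :
    twistAction h T = T ↔ ∀ g, h g ∈ Subgroup.center N := by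
  simp only [twistAction, funext_iff, mul_eq_right, conj_eq_one_iff_mem_center]

variable [Group G]

/-- The cochain measuring the failure of multiplicativity of the section `h · σ`, for a section `σ`
with factor system `(T, ω)`. -/
def twistCochain (h : G → N) (T : G → MulAut N) (ω : G × G → N) : G × G → N :=
  fun p => h p.1 * T p.1 (h p.2) * ω p * (h (p.1 * p.2))⁻¹

theorem twistCochain_inv_twistCochain (h : G → N) (T : G → MulAut N) (ω : G × G → N) :
    twistCochain h⁻¹ (twistAction h T) (twistCochain h T ω) = ω := by
  funext p
  simp [twistAction, twistCochain, mul_assoc]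

variable (S : G →* MulAut N)

theorem twistCochain_coe (z : G → Subgroup.center N) (ω : G × G → N) :
    twistCochain (fun g => (z g : N)) S ω = fun p => ω p * d1 S z p := by
  funext p
  have h : (z p.1 : N) * S p.1 (z p.2) = d1 S z p * z (p.1 * p.2) := by
    rw [coe_d1, dS_mul S fun g => (z g : N)]
  rw [twistCochain, h, mul_assoc _ (ω p), (commute_coe_center _ _).inv_left.symm.eq,
    ← mul_assoc, mul_inv_cancel_right, (commute_coe_center _ _).eq]

theorem twistAction_mul_iff {f : G → N} {g g' : G} :
    twistAction f S g * twistAction f S g' = twistAction f S (g * g') ↔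
      dS S f (g, g') ∈ Subgroup.center N := by
  have h : twistAction f S g * twistAction f S g' =
      MulAut.conj (dS S f (g, g')) * twistAction f S (g * g') := by
    simp only [twistAction]
    rw [← mul_assoc (MulAut.conj (dS S f (g, g'))), ← map_mul, dS_mul, map_mul S, map_mul,
      mul_assoc, ← mul_assoc (S g), mulAut_mul_conj]
    simp only [mul_assoc]
  rw [h, mul_eq_right, conj_eq_one_iff_mem_center]

theorem twistCochain_eq_one_iff {f : G → N} (hf : ∀ p, dS S f p ∈ Subgroup.center N)
    {ω : G × G → N} : twistCochain f S ω = 1 ↔ ω = (dS S f)⁻¹ := by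
  simp only [funext_iff]
  refine forall_congr' fun p => ?_
  have h : twistCochain f S ω p = f (p.1 * p.2) * (dS S f p * ω p) * (f (p.1 * p.2))⁻¹ := by
    rw [twistCochain, ← dS_mul, ← mul_assoc (f (p.1 * p.2)),
      (commute_coe_center ⟨_, hf p⟩ (f (p.1 * p.2))).eq]
  rw [h, Pi.one_apply, conj_eq_one_iff, mul_eq_one_iff_inv_eq, eq_comm, Pi.inv_apply]

/-- The action `g ↦ C_{f(g)} S(g)` obtained by twisting `S` with a map `f` for which `d_S f` is
central. -/
def twistedHom {f : G → N} (hf : ∀ p, dS S f p ∈ Subgroup.center N) : G →* MulAut N :=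
  MonoidHom.mk' (twistAction f S) fun _ _ => ((twistAction_mul_iff S).2 (hf _)).symm

end Twisting

section FixedPoints

variable {G N : Type*} [Group G] [Group N] (S : G →* MulAut N)

/-- The inclusion `Z(N)^G → N^G`. -/
def fixedIncl : fixedPts ((centerAut N).comp S) →* fixedPts S where
  toFun z := ⟨z.1, fun g => congrArg Subtype.val (z.2 g)⟩
  map_one' := rfl
  map_mul' _ _ := rfl

/-- The map `N^G → N_ad^G` induced by the quotient map. -/
def fixedProj : fixedPts S →* fixedPts ((adAut N).comp S) where
  toFun n := ⟨QuotientGroup.mk n.1, fun g => congrArg QuotientGroup.mk (n.2 g)⟩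
  map_one' := rfl
  map_mul' _ _ := rfl

theorem fixedIncl_injective : Function.Injective (fixedIncl S) := fun _ _ h =>
  Subtype.ext (Subtype.ext (congrArg (fun n : fixedPts S => (n : N)) h))

theorem fixedProj_ker : (fixedProj S).ker = (fixedIncl S).range := by
  ext n
  have mem_ker_iff : n ∈ (fixedProj S).ker ↔ n.1 ∈ Subgroup.center N := by
    rw [MonoidHom.mem_ker, Subtype.ext_iff]
    exact QuotientGroup.eq_one_iff n.1
  rw [mem_ker_iff]
  constructor
  · exact fun hn => ⟨⟨⟨n.1, hn⟩, fun g => Subtype.ext (n.2 g)⟩, rfl⟩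
  · rintro ⟨z, rfl⟩
    exact z.1.2

/-- The preimage of `N_ad^G` in `N`: the elements that are fixed by `G` modulo the centre. -/
def fixedModCenter : Subgroup N :=
  (fixedPts ((adAut N).comp S)).comap (QuotientGroup.mk' (Subgroup.center N))

variable {S} in
theorem mem_fixedModCenter_iff {n : N} :
    n ∈ fixedModCenter S ↔ ∀ g, n⁻¹ * S g n ∈ Subgroup.center N :=
  forall_congr' fun _ => eq_comm.trans QuotientGroup.eq

/-- The surjection onto `N_ad^G` of the elements of `N` fixed modulo the centre, by which the
connecting homomorphism is defined. -/
def modCenter : fixedModCenter S →* fixedPts ((adAut N).comp S) :=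
  (QuotientGroup.mk' (Subgroup.center N)).subgroupComap _

theorem modCenter_surjective : Function.Surjective (modCenter S) :=
  MonoidHom.subgroupComap_surjective_of_surjective _ _ (QuotientGroup.mk'_surjective _)

end FixedPoints

section Cocycles

variable {𝕜 : Type*} [RCLike 𝕜]
variable {G : Type*} [TopologicalSpace G] [Group G] [LCManifold 𝕜 G]
variable {A : Type*} [TopologicalSpace A] [Group A] [LCManifold 𝕜 A]
variable {S : G →* MulAut A}

theorem mem_Z1s_iff {f : G → A} : f ∈ Z1s 𝕜 S ↔ f ∈ C1s 𝕜 G A ∧ dS S f = 1 :=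
  and_congr_right fun _ => (dS_eq_one_iff S).symm

theorem one_mem_Z1s : 1 ∈ Z1s 𝕜 S :=
  ⟨one_mem_C1s, fun g g' => by simp⟩

theorem Z1s_subset_Z1sCentral : Z1s 𝕜 S ⊆ Z1sCentral 𝕜 S := fun _ hf =>
  ⟨hf.1, fun p => congrFun (mem_Z1s_iff.1 hf).2 p ▸ one_mem _⟩

theorem gaugeTransform_mem_C1s [LCLieGroup 𝕜 A] (hS : IsSmoothAction 𝕜 S) (n : A) {f : G → A}
    (hf : f ∈ C1s 𝕜 G A) : gaugeTransform S n f ∈ C1s 𝕜 G A :=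
  ⟨by simp [gaugeTransform, hf.1], (((smooth_const n).near 1).mul hf.2).mul
    (hS.smoothNear_apply (smooth_id.near 1) ((smooth_const n).near 1)).inv⟩

theorem gaugeTransform_mem_Z1s [LCLieGroup 𝕜 A] (hS : IsSmoothAction 𝕜 S) (n : A) {f : G → A}
    (hf : f ∈ Z1s 𝕜 S) : gaugeTransform S n f ∈ Z1s 𝕜 S := by
  rw [mem_Z1s_iff] at hf ⊢
  refine ⟨gaugeTransform_mem_C1s hS n hf.1, funext fun p => ?_⟩
  rw [dS_gaugeTransform, hf.2, Pi.one_apply, mul_one, mul_inv_cancel]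

theorem H1s.mk_surjective : Function.Surjective (H1s.mk 𝕜 S) :=
  Quotient.exists_rep

theorem H1s.mk_eq_mk_iff {f f' : Z1s 𝕜 S} :
    H1s.mk 𝕜 S f = H1s.mk 𝕜 S f' ↔ ∃ n, f'.1 = gaugeTransform S n f.1 :=
  Quotient.eq.trans (exists_congr fun _ => funext_iff.symm)

theorem H1s.mk_eq_base_iff {f : Z1s 𝕜 S} :
    H1s.mk 𝕜 S f = H1s.base 𝕜 S ↔ ∃ n : A, ∀ g, f.1 g = n⁻¹ * S g n := by
  refine H1s.mk_eq_mk_iff.trans (exists_congr fun n => (eq_comm.trans ?_).trans funext_iff)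
  rw [← gaugeTransform_inv_one, ← gaugeTransform_inv_eq_iff, inv_inv]
  rfl

end Cocycles

section CentralCocycles

theorem mk_subgroupOf_eq_mk_iff {A : Type*} [Group A] {H K : Subgroup A} {x y : K} :
    (QuotientGroup.mk x : K ⧸ H.subgroupOf K) = QuotientGroup.mk y ↔
      ∃ b ∈ H, (y : A) = x * b := by
  rw [QuotientGroup.eq, Subgroup.mem_subgroupOf]
  constructor
  · exact fun h => ⟨_, h, (mul_inv_cancel_left _ _).symm⟩
  · rintro ⟨b, hb, h⟩
    simpa [h] using hb

variable {𝕜 : Type*} [RCLike 𝕜]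
variable {G : Type*} [TopologicalSpace G] [Group G] [LCManifold 𝕜 G]
variable {N : Type*} [TopologicalSpace N] [Group N] [LCManifold 𝕜 N] [LCLieGroup 𝕜 N]
variable {S : G →* MulAut N}

theorem mem_Z1sZ_iff {c : G → Subgroup.center N} :
    c ∈ Z1sZ 𝕜 S ↔ (fun g => (c g : N)) ∈ Z1s 𝕜 S := by
  rw [mem_Z1s_iff]
  refine and_congr_right fun _ => ?_
  simp only [funext_iff, ← coe_d1, Pi.one_apply, OneMemClass.coe_eq_one]
  exact MonoidHom.mem_ker.trans funext_iff

theorem mul_mem_Z1sCentral {f : G → N} (hf : f ∈ Z1sCentral 𝕜 S) {z : G → Subgroup.center N}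
    (hz : z ∈ C1sZ 𝕜 G N) : (fun g => f g * z g) ∈ Z1sCentral 𝕜 S :=
  ⟨mul_mem_C1s hf.1 hz, fun p => by
    rw [dS_mul_coe]
    exact mul_mem (hf.2 p) (d1 S z p).2⟩

theorem H1sZ.mk_eq_mk_iff {c c' : Z1sZ 𝕜 S} :
    (QuotientGroup.mk c : H1sZ 𝕜 S) = QuotientGroup.mk c' ↔
      ∃ z : Subgroup.center N, c'.1 = c.1 * d0 S z := by
  simp only [mk_subgroupOf_eq_mk_iff, MonoidHom.mem_range, exists_exists_eq_and]

theorem H2ssZ.mk_eq_mk_iff {β β' : Z2ssZ 𝕜 S} :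
    (QuotientGroup.mk β : H2ssZ 𝕜 S) = QuotientGroup.mk β' ↔
      ∃ z ∈ C1sZ 𝕜 G N, β'.1 = β.1 * d1 S z := by
  simp only [mk_subgroupOf_eq_mk_iff, B2sZ, Subgroup.mem_map, exists_exists_and_eq_and]

/-- The map `H^1_s(G, Z(N)) → H^1_s(G, N)` induced by the inclusion. -/
def H1sZ.toH1s : H1sZ 𝕜 S → H1s 𝕜 S :=
  Quotient.lift (fun c : Z1sZ 𝕜 S => H1s.mk 𝕜 S ⟨fun g => (c.1 g : N), mem_Z1sZ_iff.1 c.2⟩)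
    fun c c' h => by
      obtain ⟨z, hz⟩ := H1sZ.mk_eq_mk_iff.1 (Quotient.sound h)
      exact H1s.mk_eq_mk_iff.2 ⟨(z : N)⁻¹, funext fun g =>
        (congrArg Subtype.val (congrFun hz g)).trans (coe_mul_d0 S c.1 z g)⟩

theorem H1sZ.toH1s_mk_eq_base_iff {c : Z1sZ 𝕜 S} :
    H1sZ.toH1s (QuotientGroup.mk c : H1sZ 𝕜 S) = H1s.base 𝕜 S ↔
      ∃ n : N, ∀ g, (c.1 g : N) = n⁻¹ * S g n :=
  H1s.mk_eq_base_iff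

end CentralCocycles

section ConnectingHom

variable {𝕜 : Type*} [RCLike 𝕜]
variable {G : Type*} [TopologicalSpace G] [Group G] [LCManifold 𝕜 G]
variable {N : Type*} [TopologicalSpace N] [Group N] [LCManifold 𝕜 N] [LCLieGroup 𝕜 N]
variable {S : G →* MulAut N}

/-- The crossed homomorphism `g ↦ n⁻¹ S(g)(n)` attached to an element `n` that is fixed modulo the
centre. It is a coboundary in `N`, but in general not in `Z(N)`. -/
def coboundaryHom (hS : IsSmoothAction 𝕜 S) : fixedModCenter S →* Z1sZ 𝕜 S where
  toFun n := ⟨fun g => ⟨(n : N)⁻¹ * S g n, mem_fixedModCenter_iff.1 n.2 g⟩, mem_Z1sZ_iff.2 <|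
    gaugeTransform_inv_one S (n : N) ▸ gaugeTransform_mem_Z1s hS _ one_mem_Z1s⟩
  map_one' := by ext g; simp
  map_mul' n m := by
    ext g
    change ((n : N) * m)⁻¹ * S g (n * m) = (n : N)⁻¹ * S g n * ((m : N)⁻¹ * S g m)
    have h := commute_coe_center ⟨_, mem_fixedModCenter_iff.1 n.2 g⟩ (m : N)⁻¹
    rw [← mul_assoc, h.eq, map_mul]
    group

theorem coboundaryHom_eq_d0_iff (hS : IsSmoothAction 𝕜 S) {n : fixedModCenter S}
    {z : Subgroup.center N} :
    (coboundaryHom hS n).1 = d0 S z ↔ (n : N) * (z : N)⁻¹ ∈ fixedPts S := by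
  rw [funext_iff]
  refine forall_congr' fun g => ?_
  have hz : (d0 S z g : N) = (z : N)⁻¹ * S g z := by
    simpa [gaugeTransform] using coe_mul_d0 S 1 z g
  rw [Subtype.ext_iff, hz, map_mul, map_inv, mul_inv_eq_iff_eq_mul, mul_assoc]
  exact inv_mul_eq_iff_eq_mul

theorem mk_coboundaryHom_eq_one_iff (hS : IsSmoothAction 𝕜 S) {n : fixedModCenter S} :
    (QuotientGroup.mk (coboundaryHom hS n) : H1sZ 𝕜 S) = 1 ↔
      ∃ z : Subgroup.center N, (n : N) * (z : N)⁻¹ ∈ fixedPts S := by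
  rw [QuotientGroup.eq_one_iff, Subgroup.mem_subgroupOf, MonoidHom.mem_range]
  exact exists_congr fun z => eq_comm.trans (coboundaryHom_eq_d0_iff hS)

/-- The connecting homomorphism `δ₀ : N_ad^G → H^1_s(G, Z(N))_S`. -/
noncomputable def connectingHom (hS : IsSmoothAction 𝕜 S) :
    fixedPts ((adAut N).comp S) →* H1sZ 𝕜 S :=
  (modCenter S).liftOfSurjective (modCenter_surjective S)
    ⟨(QuotientGroup.mk' _).comp (coboundaryHom hS), fun n hn => by
      have hn : (n : N) ∈ Subgroup.center N :=
        (QuotientGroup.eq_one_iff _).1 (congrArg Subtype.val (MonoidHom.mem_ker.1 hn))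
      exact (mk_coboundaryHom_eq_one_iff hS).2 ⟨⟨n, hn⟩, by simp⟩⟩

theorem connectingHom_modCenter (hS : IsSmoothAction 𝕜 S) (n : fixedModCenter S) :
    connectingHom hS (modCenter S n) = QuotientGroup.mk (coboundaryHom hS n) :=
  MonoidHom.liftOfRightInverse_comp_apply _ _ _ _ n

theorem connectingHom_ker (hS : IsSmoothAction 𝕜 S) :
    (connectingHom hS).ker = (fixedProj S).range := by
  ext x
  obtain ⟨n, rfl⟩ := modCenter_surjective S x
  rw [MonoidHom.mem_ker, connectingHom_modCenter, mk_coboundaryHom_eq_one_iff]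
  constructor
  · rintro ⟨z, hz⟩
    exact ⟨⟨_, hz⟩, Subtype.ext (QuotientGroup.mk_mul_of_mem _ (inv_mem z.2))⟩
  · rintro ⟨m, hm⟩
    have hmn : (m : N)⁻¹ * n ∈ Subgroup.center N := QuotientGroup.eq.1 (congrArg Subtype.val hm)
    exact ⟨⟨_, hmn⟩, by simp⟩

theorem H1sZ.toH1s_eq_base_iff (hS : IsSmoothAction 𝕜 S) (c : H1sZ 𝕜 S) :
    H1sZ.toH1s c = H1s.base 𝕜 S ↔ c ∈ (connectingHom hS).range := by
  rw [MonoidHom.mem_range, (modCenter_surjective S).exists]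
  simp only [connectingHom_modCenter]
  constructor
  · obtain ⟨c, rfl⟩ := QuotientGroup.mk_surjective c
    rw [H1sZ.toH1s_mk_eq_base_iff]
    rintro ⟨n, hn⟩
    have hn' : n ∈ fixedModCenter S := mem_fixedModCenter_iff.2 fun g => hn g ▸ (c.1 g).2
    exact ⟨⟨n, hn'⟩, congrArg _ (Subtype.ext (funext fun g => Subtype.ext (hn g).symm))⟩
  · rintro ⟨n, rfl⟩
    exact H1sZ.toH1s_mk_eq_base_iff.2 ⟨n, fun _ => rfl⟩

end ConnectingHom

section CentralDifferential

variable {𝕜 : Type*} [RCLike 𝕜]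
variable {G : Type*} [TopologicalSpace G] [Group G] [LCManifold 𝕜 G] [LCLieGroup 𝕜 G]
variable {N : Type*} [TopologicalSpace N] [Group N] [LCManifold 𝕜 N] [LCLieGroup 𝕜 N]
variable {S : G →* MulAut N}

theorem dS_mem_C2s (hS : IsSmoothAction 𝕜 S) {f : G → N} (hf : f ∈ C1s 𝕜 G N) :
    dS S f ∈ C2s 𝕜 G N := by
  have smooth_left : SmoothNear 𝕜 (fun p : G × G => f p.1) (1, 1) :=
    hf.2.comp_of_eq (smooth_fst.near _) rfl
  have smooth_right : SmoothNear 𝕜 (fun p : G × G => f p.2) (1, 1) :=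
    hf.2.comp_of_eq (smooth_snd.near _) rfl
  have smooth_mul : SmoothNear 𝕜 (fun p : G × G => f (p.1 * p.2)) (1, 1) :=
    hf.2.comp_of_eq ((smooth_fst.mul smooth_snd).near _) (mul_one 1)
  exact ⟨fun g => by simp [dS, hf.1],
    (smooth_left.mul (hS.smoothNear_apply (smooth_fst.near _) smooth_right)).mul smooth_mul.inv⟩

theorem dS_mem_C2ss (hS : IsSmoothAction 𝕜 S) {f : G → N} (hf : f ∈ C1s 𝕜 G N) :
    dS S f ∈ C2ss 𝕜 G N := by
  refine ⟨dS_mem_C2s hS hf, fun g => ?_⟩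
  have smooth_conj : SmoothNear 𝕜 (fun x : G => g * x * g⁻¹) 1 :=
    (((smooth_const g).mul smooth_id).mul (smooth_const g⁻¹)).near 1
  have smooth_left : SmoothNear 𝕜 (fun x => f g * S g (f x)) 1 :=
    ((smooth_const _).near 1).mul (hS.smoothNear_apply ((smooth_const g).near 1) hf.2)
  have smooth_right : SmoothNear 𝕜 (fun x => f (g * x * g⁻¹) * S (g * x * g⁻¹) (f g)) 1 :=
    (hf.2.comp_of_eq smooth_conj (by simp)).mul
      (hS.smoothNear_apply smooth_conj ((smooth_const _).near 1))
  -- The factors `f (g * x)⁻¹`, which need not be smooth near `x = 1`, cancel.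
  have cancel (x : G) : dS S f (g, x) * (dS S f (g * x * g⁻¹, g))⁻¹ =
      f g * S g (f x) * (f (g * x * g⁻¹) * S (g * x * g⁻¹) (f g))⁻¹ := by
    simp [dS, mul_assoc]
  simpa only [cancel] using smooth_left.mul smooth_right.inv

/-- The `2`-cocycle `d_S f` with values in the centre, for `f ∈ Z^1_s(G, N, Z(N))_S`. -/
def centralCocycle (hS : IsSmoothAction 𝕜 S) (f : Z1sCentral 𝕜 S) : Z2ssZ 𝕜 S :=
  ⟨fun p => ⟨dS S f.1 p, f.2.2 p⟩, dS_mem_C2ss hS f.2.1, MonoidHom.mem_ker.2 <| by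
    funext ⟨a, b, c⟩
    refine (div_mul_div_comm _ _ _ _).trans (div_eq_one.2 (Subtype.ext ?_))
    have h := conj_dS_mul_dS S f.1 a b c
    have h_central : MulAut.conj (f.1 a) (S a (dS S f.1 (b, c))) = S a (dS S f.1 (b, c)) := by
      rw [MulAut.conj_apply, mul_inv_eq_iff_eq_mul]
      exact (commute_coe_center (centerAut N (S a) ⟨_, f.2.2 (b, c)⟩) _).eq.symm
    rw [h_central] at h
    exact h.trans (commute_coe_center ⟨_, f.2.2 (a, b)⟩ _).eq⟩

theorem mk_centralCocycle_gaugeTransform (hS : IsSmoothAction 𝕜 S) {f f' : Z1sCentral 𝕜 S} {n : N}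
    {z : G → Subgroup.center N} (hz : z ∈ C1sZ 𝕜 G N)
    (h : f'.1 = gaugeTransform S n (fun g => f.1 g * z g)) :
    (QuotientGroup.mk (centralCocycle hS f) : H2ssZ 𝕜 S) =
      QuotientGroup.mk (centralCocycle hS f') := by
  refine H2ssZ.mk_eq_mk_iff.2 ⟨z, hz, funext fun p => Subtype.ext ?_⟩
  change dS S f'.1 p = dS S f.1 p * d1 S z p
  rw [h, dS_gaugeTransform, dS_mul_coe, mul_inv_eq_iff_eq_mul]
  exact (commute_coe_center (⟨_, f.2.2 p⟩ * d1 S z p) n).eq.symm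

theorem mk_centralCocycle_eq_one_iff (hS : IsSmoothAction 𝕜 S) {f : Z1sCentral 𝕜 S} :
    (QuotientGroup.mk (centralCocycle hS f) : H2ssZ 𝕜 S) = 1 ↔
      ∃ z ∈ C1sZ 𝕜 G N, (fun g => f.1 g * z g) ∈ Z1s 𝕜 S := by
  rw [eq_comm, ← QuotientGroup.mk_one, eq_comm, H2ssZ.mk_eq_mk_iff]
  refine exists_congr fun z => and_congr_right fun hz => ?_
  rw [mem_Z1s_iff, and_iff_right (mul_mem_Z1sCentral f.2 hz).1, eq_comm]
  simp only [funext_iff, dS_mul_coe, Subtype.ext_iff]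
  rfl

end CentralDifferential

section ConnectingMap

variable {𝕜 : Type*} [RCLike 𝕜]
variable {G : Type*} [TopologicalSpace G] [Group G] [LCManifold 𝕜 G]
variable {N : Type*} [TopologicalSpace N] [Group N] [LCManifold 𝕜 N]
variable [LCManifold 𝕜 (Subgroup.center N)] [LCLieGroup 𝕜 (Subgroup.center N)]
variable [LCManifold 𝕜 (N ⧸ Subgroup.center N)]
variable {S : G →* MulAut N}

/-- The image in `Z^1_s(G, N_ad)` of a map in `Z^1_s(G, N, Z(N))`. -/
def adCocycle (hZ : IsSplitLieSubgroup 𝕜 (Subgroup.center N)) (f : Z1sCentral 𝕜 S) :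
    Z1s 𝕜 ((adAut N).comp S) :=
  ⟨fun g => QuotientGroup.mk (f.1 g), mem_Z1s_iff.2 ⟨comp_mem_C1s hZ.smooth_q.mem_C1s f.2.1,
    funext fun p => (QuotientGroup.eq_one_iff _).2 (f.2.2 p)⟩⟩

/-- The class in `H^1_s(G, N_ad)` of the image of a map in `Z^1_s(G, N, Z(N))`. -/
def adClass (hZ : IsSplitLieSubgroup 𝕜 (Subgroup.center N)) (f : Z1sCentral 𝕜 S) :
    H1s 𝕜 ((adAut N).comp S) :=
  H1s.mk 𝕜 _ (adCocycle hZ f)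

/-- The map `H^1_s(G, N) → H^1_s(G, N_ad)` induced by the quotient map. -/
def H1s.toAd (hZ : IsSplitLieSubgroup 𝕜 (Subgroup.center N)) :
    H1s 𝕜 S → H1s 𝕜 ((adAut N).comp S) :=
  Quotient.lift (fun f : Z1s 𝕜 S => adClass hZ ⟨f.1, Z1s_subset_Z1sCentral f.2⟩)
    fun _ _ ⟨n, hn⟩ => H1s.mk_eq_mk_iff.2
      ⟨QuotientGroup.mk n, funext fun g => congrArg QuotientGroup.mk (hn g)⟩

theorem H1s.toAd_mk (hZ : IsSplitLieSubgroup 𝕜 (Subgroup.center N)) (f : Z1s 𝕜 S) :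
    H1s.toAd hZ (H1s.mk 𝕜 S f) = adClass hZ ⟨f.1, Z1s_subset_Z1sCentral f.2⟩ :=
  rfl

variable [LCLieGroup 𝕜 N]

theorem adCocycle_surjective (hZ : IsSplitLieSubgroup 𝕜 (Subgroup.center N)) :
    Function.Surjective (adCocycle (S := S) hZ) := by
  intro f
  obtain ⟨σ, hσ, hσq⟩ := IsLieExtension.exists_section_mem_C1s hZ
  have mk_σ (g : G) : (QuotientGroup.mk (σ (f.1 g)) : N ⧸ Subgroup.center N) = f.1 g := hσq _
  have dS_central (p : G × G) : dS S (fun g => σ (f.1 g)) p ∈ Subgroup.center N := by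
    rw [← QuotientGroup.eq_one_iff]
    change dS ((adAut N).comp S) (fun g => QuotientGroup.mk (σ (f.1 g))) p = 1
    simp only [mk_σ, (mem_Z1s_iff.1 f.2).2, Pi.one_apply]
  exact ⟨⟨_, comp_mem_C1s hσ f.2.1, dS_central⟩, Subtype.ext (funext mk_σ)⟩

theorem adClass_surjective (hZ : IsSplitLieSubgroup 𝕜 (Subgroup.center N)) :
    Function.Surjective (adClass (S := S) hZ) :=
  H1s.mk_surjective.comp (adCocycle_surjective hZ)

theorem adClass_eq_adClass_iff (hZ : IsSplitLieSubgroup 𝕜 (Subgroup.center N))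
    (hS : IsSmoothAction 𝕜 S) {f f' : Z1sCentral 𝕜 S} :
    adClass hZ f = adClass hZ f' ↔
      ∃ n : N, ∃ z ∈ C1sZ 𝕜 G N, f'.1 = gaugeTransform S n (fun g => f.1 g * z g) := by
  refine H1s.mk_eq_mk_iff.trans ?_
  rw [(QuotientGroup.mk_surjective (s := Subgroup.center N)).exists]
  refine exists_congr fun n => ?_
  have mk_gaugeTransform_iff : (adCocycle hZ f').1 = gaugeTransform ((adAut N).comp S)
      (QuotientGroup.mk n) (adCocycle hZ f).1 ↔
      ∀ g, (f.1 g)⁻¹ * gaugeTransform S n⁻¹ f'.1 g ∈ Subgroup.center N := by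
    rw [← gaugeTransform_inv_eq_iff, eq_comm, funext_iff]
    exact forall_congr' fun g => QuotientGroup.eq
  simp only [mk_gaugeTransform_iff, ← gaugeTransform_inv_eq_iff]
  constructor
  · intro h
    exact ⟨fun g => ⟨_, h g⟩,
      mul_mem_C1s (inv_mem_C1s f.2.1) (gaugeTransform_mem_C1s hS n⁻¹ f'.2.1),
      funext fun g => (mul_inv_cancel_left _ _).symm⟩
  · rintro ⟨z, -, h⟩ g
    rw [h, inv_mul_cancel_left]
    exact (z g).2

theorem H1s.toAd_eq_base_iff (hZ : IsSplitLieSubgroup 𝕜 (Subgroup.center N))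
    (hS : IsSmoothAction 𝕜 S) (x : H1s 𝕜 S) :
    H1s.toAd hZ x = H1s.base 𝕜 ((adAut N).comp S) ↔ x ∈ range (H1sZ.toH1s (S := S)) := by
  have mem_range_iff : x ∈ range (H1sZ.toH1s (S := S)) ↔
      ∃ c : Z1sZ 𝕜 S, H1sZ.toH1s (QuotientGroup.mk c) = x :=
    QuotientGroup.mk_surjective.exists
  rw [mem_range_iff]
  constructor
  · obtain ⟨f, rfl⟩ := H1s.mk_surjective x
    intro h
    obtain ⟨n, z, -, hf⟩ := (adClass_eq_adClass_iff hZ hS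
      (f := ⟨1, Z1s_subset_Z1sCentral one_mem_Z1s⟩)).1 h.symm
    replace hf : f.1 = gaugeTransform S n (fun g => z g) := by simpa using hf
    have hz : z ∈ Z1sZ 𝕜 S := mem_Z1sZ_iff.2 <|
      gaugeTransform_inv_eq_iff S |>.2 hf ▸ gaugeTransform_mem_Z1s hS n⁻¹ f.2
    exact ⟨⟨z, hz⟩, H1s.mk_eq_mk_iff.2 ⟨n, hf⟩⟩
  · rintro ⟨c, rfl⟩
    exact congrArg (H1s.mk 𝕜 _)
      (Subtype.ext (funext fun g => (QuotientGroup.eq_one_iff _).2 (c.1 g).2))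

variable [LCLieGroup 𝕜 G]

/-- The connecting map `δ : H^1_s(G, N_ad) → H^2_ss(G, Z(N))_S`, given by the differential of a
lift in `Z^1_s(G, N, Z(N))_S`. -/
noncomputable def connectingMap (hZ : IsSplitLieSubgroup 𝕜 (Subgroup.center N))
    (hS : IsSmoothAction 𝕜 S) (y : H1s 𝕜 ((adAut N).comp S)) : H2ssZ 𝕜 S :=
  QuotientGroup.mk (centralCocycle hS (Function.surjInv (adClass_surjective hZ) y))

theorem connectingMap_adClass (hZ : IsSplitLieSubgroup 𝕜 (Subgroup.center N))
    (hS : IsSmoothAction 𝕜 S) (f : Z1sCentral 𝕜 S) :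
    connectingMap hZ hS (adClass hZ f) = QuotientGroup.mk (centralCocycle hS f) := by
  obtain ⟨n, z, hz, h⟩ :=
    (adClass_eq_adClass_iff hZ hS).1 (Function.surjInv_eq (adClass_surjective hZ) (adClass hZ f))
  exact mk_centralCocycle_gaugeTransform hS hz h

theorem range_connectingMap (hZ : IsSplitLieSubgroup 𝕜 (Subgroup.center N))
    (hS : IsSmoothAction 𝕜 S) :
    range (connectingMap hZ hS) = range fun f => QuotientGroup.mk (centralCocycle hS f) := by
  rw [← (adClass_surjective hZ).range_comp]
  exact congrArg range (funext (connectingMap_adClass hZ hS))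

theorem connectingMap_eq_one_iff (hZ : IsSplitLieSubgroup 𝕜 (Subgroup.center N))
    (hS : IsSmoothAction 𝕜 S) (y : H1s 𝕜 ((adAut N).comp S)) :
    connectingMap hZ hS y = 1 ↔ y ∈ range (H1s.toAd (S := S) hZ) := by
  rw [mem_range, H1s.mk_surjective.exists]
  simp only [H1s.toAd_mk]
  constructor
  · obtain ⟨f, rfl⟩ := adClass_surjective hZ y
    rw [connectingMap_adClass, mk_centralCocycle_eq_one_iff]
    rintro ⟨z, hz, hfz⟩
    refine ⟨⟨_, hfz⟩, ((adClass_eq_adClass_iff hZ hS).2 ⟨1, z, hz, ?_⟩).symm⟩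
    rw [gaugeTransform_one]
  · rintro ⟨f, rfl⟩
    rw [connectingMap_adClass, mk_centralCocycle_eq_one_iff]
    exact ⟨1, one_mem _, by simp⟩

end ConnectingMap

section FactorSystems

variable {𝕜 : Type*} [RCLike 𝕜]
variable {G : Type*} [TopologicalSpace G] [Group G] [LCManifold 𝕜 G]
variable {N : Type*} [TopologicalSpace N] [Group N] [LCManifold 𝕜 N]
variable {X Y : LieExt 𝕜 G N} {σ : G → X.carrier} {T T' : G → MulAut N} {ω ω' : G × G → N}

/-- The section `σ` of the extension `X` has the factor system `(T, ω)`. The defining identities are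
stated without inverses, as commutation rules in `X`. -/
structure LieExt.IsFactorSystem (X : LieExt 𝕜 G N) (σ : G → X.carrier) (T : G → MulAut N)
    (ω : G × G → N) : Prop where
  mem_C1s : σ ∈ C1s 𝕜 G X.carrier
  q_section (g : G) : X.q (σ g) = g
  mul_ι (g : G) (n : N) : σ g * X.ι n = X.ι (T g n) * σ g
  mul_section (g g' : G) : σ g * σ g' = X.ι (ω (g, g')) * σ (g * g')

theorem LieExt.hasFactorSystem_iff :
    X.HasFactorSystem T ω ↔ ∃ σ, X.IsFactorSystem σ T ω := by
  refine exists_congr fun σ => ?_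
  simp only [mul_inv_eq_iff_eq_mul]
  exact ⟨fun ⟨h₁, h₂, h₃, h₄⟩ => ⟨h₁, h₂, h₃, h₄⟩, fun ⟨h₁, h₂, h₃, h₄⟩ => ⟨h₁, h₂, h₃, h₄⟩⟩

theorem LieExt.IsFactorSystem.mul_mul (h : X.IsFactorSystem σ T ω) (n n' : N) (g g' : G) :
    X.ι n * σ g * (X.ι n' * σ g') = X.ι (n * T g n' * ω (g, g')) * σ (g * g') := by
  simp only [map_mul, mul_assoc, ← h.mul_section]
  rw [← mul_assoc (σ g), h.mul_ι, mul_assoc]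

theorem LieExt.IsFactorSystem.action_mul (h : X.IsFactorSystem σ T ω) (g g' : G) :
    T g * T g' = MulAut.conj (ω (g, g')) * T (g * g') := by
  ext n
  refine X.isLieExtension.injective (mul_right_cancel (b := σ g * σ g') ?_)
  calc X.ι (T g (T g' n)) * (σ g * σ g')
      = σ g * σ g' * X.ι n := by
        rw [mul_assoc, h.mul_ι g' n, ← mul_assoc, ← h.mul_ι, mul_assoc]
    _ = X.ι (ω (g, g') * T (g * g') n) * σ (g * g') := by
        rw [h.mul_section, mul_assoc, h.mul_ι, ← mul_assoc, ← map_mul]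
    _ = X.ι (MulAut.conj (ω (g, g')) (T (g * g') n)) * (σ g * σ g') := by
        rw [h.mul_section, ← mul_assoc, ← map_mul, MulAut.conj_apply, inv_mul_cancel_right]

theorem LieExt.IsFactorSystem.unique (h : X.IsFactorSystem σ T ω)
    (h' : X.IsFactorSystem σ T' ω') : T = T' ∧ ω = ω' :=
  ⟨funext fun g => MulEquiv.ext fun n => X.isLieExtension.injective <|
      mul_right_cancel ((h.mul_ι g n).symm.trans (h'.mul_ι g n)),
    funext fun p => X.isLieExtension.injective <|
      mul_right_cancel ((h.mul_section p.1 p.2).symm.trans (h'.mul_section p.1 p.2))⟩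

theorem LieExt.IsFactorSystem.twist (h : X.IsFactorSystem σ T ω) {f : G → N}
    (hf : f ∈ C1s 𝕜 G N) :
    X.IsFactorSystem (fun g => X.ι (f g) * σ g) (twistAction f T) (twistCochain f T ω) where
  mem_C1s := mul_mem_C1s (comp_mem_C1s X.isLieExtension.smooth_ι.mem_C1s hf) h.mem_C1s
  q_section g := by rw [map_mul, X.isLieExtension.q_ι, h.q_section, one_mul]
  mul_ι g n := by
    rw [mul_assoc, h.mul_ι, twistAction, MulAut.mul_apply, MulAut.conj_apply]
    simp only [← mul_assoc, ← map_mul, inv_mul_cancel_right]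
  mul_section g g' := by
    rw [h.mul_mul, ← mul_assoc, ← map_mul, twistCochain, inv_mul_cancel_right]

theorem LieExt.HasFactorSystem.twist (hX : X.HasFactorSystem T ω) {f : G → N}
    (hf : f ∈ C1s 𝕜 G N) : X.HasFactorSystem (twistAction f T) (twistCochain f T ω) := by
  rw [LieExt.hasFactorSystem_iff] at hX ⊢
  obtain ⟨σ, hσ⟩ := hX
  exact ⟨_, hσ.twist hf⟩

theorem LieExt.HasFactorSystem.of_equivalent (hX : X.HasFactorSystem T ω) (e : X.Equivalent Y) :
    Y.HasFactorSystem T ω := by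
  rw [LieExt.hasFactorSystem_iff] at hX ⊢
  obtain ⟨σ, hσ⟩ := hX
  obtain ⟨φ, hφ, hφι, hφq⟩ := e
  refine ⟨fun g => φ (σ g), comp_mem_C1s hφ.mem_C1s hσ.mem_C1s,
    fun g => (hφq _).trans (hσ.q_section g), fun g n => ?_, fun g g' => ?_⟩
  · rw [← hφι, ← hφι, ← map_mul, hσ.mul_ι, map_mul]
  · rw [← hφι, ← map_mul, hσ.mul_section, map_mul]

theorem LieExt.Split.of_equivalent (hX : X.Split) (e : X.Equivalent Y) : Y.Split := by
  obtain ⟨σ, hσ, hσq⟩ := hX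
  obtain ⟨φ, hφ, -, hφq⟩ := e
  exact ⟨φ.comp σ, hφ.comp hσ, fun g => (hφq _).trans (hσq g)⟩

theorem LieExt.IsFactorSystem.fiberCoord_mul (h : X.IsFactorSystem σ T ω) {ν : X.carrier → N}
    (hν : ∀ x, X.ι (ν x) * σ (X.q x) = x) (x y : X.carrier) :
    ν (x * y) = ν x * T (X.q x) (ν y) * ω (X.q x, X.q y) := by
  refine X.isLieExtension.injective (mul_right_cancel (b := σ (X.q x * X.q y)) ?_)
  rw [← h.mul_mul, hν, hν, ← map_mul, hν]

variable [LCLieGroup 𝕜 N]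

theorem LieExt.cls_eq_cls_iff : X.cls = Y.cls ↔ X.Equivalent Y :=
  Quotient.eq (r := LieExt.setoid 𝕜 G N)

theorem LieExt.hasFactorSystem_twist_iff {f : G → N} (hf : f ∈ C1s 𝕜 G N) :
    X.HasFactorSystem (twistAction f T) (twistCochain f T ω) ↔ X.HasFactorSystem T ω := by
  refine ⟨fun hX => ?_, fun hX => hX.twist hf⟩
  simpa only [twistAction_inv_twistAction, twistCochain_inv_twistCochain] using
    hX.twist (inv_mem_C1s hf)

theorem LieExt.IsFactorSystem.exists_eq_ι_mul (h : X.IsFactorSystem σ T ω) {τ : G → X.carrier}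
    (hτ : τ ∈ C1s 𝕜 G X.carrier) (hτq : ∀ g, X.q (τ g) = g) :
    ∃ f ∈ C1s 𝕜 G N, τ = fun g => X.ι (f g) * σ g := by
  obtain ⟨ν, hν, hνσ⟩ := X.isLieExtension.exists_fiberCoord h.mem_C1s h.q_section
  exact ⟨_, comp_mem_C1s hν hτ, funext fun g => by simpa only [hτq] using (hνσ (τ g)).symm⟩

theorem LieExt.HasFactorSystem.exists_twist (hX : X.HasFactorSystem T ω)
    (hX' : X.HasFactorSystem T' ω') :
    ∃ f ∈ C1s 𝕜 G N, T' = twistAction f T ∧ ω' = twistCochain f T ω := by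
  obtain ⟨σ, hσ⟩ := LieExt.hasFactorSystem_iff.1 hX
  obtain ⟨τ, hτ⟩ := LieExt.hasFactorSystem_iff.1 hX'
  obtain ⟨f, hf, rfl⟩ := hσ.exists_eq_ι_mul hτ.mem_C1s hτ.q_section
  exact ⟨f, hf, hτ.unique (hσ.twist hf)⟩

theorem LieExt.HasFactorSystem.equivalent (hX : X.HasFactorSystem T ω)
    (hY : Y.HasFactorSystem T ω) : X.Equivalent Y := by
  obtain ⟨σ, hσ⟩ := LieExt.hasFactorSystem_iff.1 hX
  obtain ⟨τ, hτ⟩ := LieExt.hasFactorSystem_iff.1 hY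
  obtain ⟨ν, hν, hνσ⟩ := X.isLieExtension.exists_fiberCoord hσ.mem_C1s hσ.q_section
  let φ : X.carrier →* Y.carrier := MonoidHom.mk' (fun x => Y.ι (ν x) * τ (X.q x)) fun x y => by
    rw [hτ.mul_mul, hσ.fiberCoord_mul hνσ, map_mul X.q]
  have smoothNear_φ : SmoothNear 𝕜 φ 1 :=
    (mul_mem_C1s (comp_mem_C1s Y.isLieExtension.smooth_ι.mem_C1s hν)
      (comp_mem_C1s hτ.mem_C1s X.isLieExtension.smooth_q.mem_C1s)).2
  refine ⟨φ, smooth_of_smoothNear_one smoothNear_φ, fun n => ?_, fun x => ?_⟩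
  · have ν_ι : ν (X.ι n) = n := X.isLieExtension.injective <| by
      simpa only [X.isLieExtension.q_ι, hσ.mem_C1s.1, mul_one] using hνσ (X.ι n)
    change Y.ι (ν (X.ι n)) * τ (X.q (X.ι n)) = Y.ι n
    rw [ν_ι, X.isLieExtension.q_ι, hτ.mem_C1s.1, mul_one]
  · change Y.q (Y.ι (ν x) * τ (X.q x)) = X.q x
    rw [map_mul, Y.isLieExtension.q_ι, hτ.q_section, one_mul]

theorem LieExt.HasFactorSystem.split_iff [LCLieGroup 𝕜 G] (hX : X.HasFactorSystem T ω) :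
    X.Split ↔ ∃ f ∈ C1s 𝕜 G N, twistCochain f T ω = 1 := by
  obtain ⟨σ, hσ⟩ := LieExt.hasFactorSystem_iff.1 hX
  constructor
  · rintro ⟨τ, hτ, hτq⟩
    obtain ⟨f, hf, hτσ⟩ := hσ.exists_eq_ι_mul hτ.mem_C1s hτq
    refine ⟨f, hf, funext fun ⟨g, g'⟩ => X.isLieExtension.injective ?_⟩
    have h := (hσ.twist hf).mul_section g g'
    simp only [← congrFun hτσ, ← map_mul τ] at h
    rw [right_eq_mul.1 h, Pi.one_apply, map_one]
  · rintro ⟨f, hf, hω⟩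
    have h := hω ▸ hσ.twist hf
    exact ⟨MonoidHom.mk' (fun g => X.ι (f g) * σ g) fun g g' => by
      rw [h.mul_section, Pi.one_apply, map_one, one_mul],
      smooth_of_smoothNear_one h.mem_C1s.2, h.q_section⟩

end FactorSystems

section ExtensionsWithKernel

variable {𝕜 : Type*} [RCLike 𝕜]
variable {G : Type*} [TopologicalSpace G] [Group G] [LCManifold 𝕜 G]
variable {N : Type*} [TopologicalSpace N] [Group N] [LCManifold 𝕜 N] [LCLieGroup 𝕜 N]
variable {X Y : LieExt 𝕜 G N} {S : G →* MulAut N} {ω ω' : G × G → N}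

theorem LieExt.HasFactorSystem.mul_d1 (hX : X.HasFactorSystem S ω) {z : G → Subgroup.center N}
    (hz : z ∈ C1sZ 𝕜 G N) : X.HasFactorSystem S (fun p => ω p * d1 S z p) := by
  have h := hX.twist (f := fun g => (z g : N)) hz
  rwa [twistAction_eq_self_iff.2 fun g => (z g).2, twistCochain_coe] at h

theorem LieExt.HasFactorSystem.exists_d1 (hX : X.HasFactorSystem S ω)
    (hX' : X.HasFactorSystem S ω') :
    ∃ z ∈ C1sZ 𝕜 G N, ω' = fun p => ω p * (d1 S z p : N) := by
  obtain ⟨f, hf, hS, hω⟩ := hX.exists_twist hX'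
  have f_central := twistAction_eq_self_iff.1 hS.symm
  exact ⟨fun g => ⟨f g, f_central g⟩, hf, hω.trans (twistCochain_coe S (fun g => ⟨f g, _⟩) ω)⟩

theorem mem_ExtKernel_iff {y : LieExtClass 𝕜 G N} :
    y ∈ ExtKernel 𝕜 S ↔ ∃ X : LieExt 𝕜 G N, X.cls = y ∧ ∃ ω, X.HasFactorSystem S ω := by
  refine exists_congr fun X => and_congr_right fun _ => ?_
  constructor
  · rintro ⟨T, ω, hX, f, hf, hT⟩
    obtain rfl : T = twistAction f S := funext hT
    have h := hX.twist (inv_mem_C1s hf)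
    rw [twistAction_inv_twistAction] at h
    exact ⟨_, h⟩
  · rintro ⟨ω, hX⟩
    exact ⟨S, ω, hX, 1, one_mem_C1s, congrFun (twistAction_one S).symm⟩

theorem LieExt.HasFactorSystem.extAct_mk_iff (hX : X.HasFactorSystem S ω) {β : Z2ssZ 𝕜 S}
    {y : LieExtClass 𝕜 G N} :
    ExtAct S (QuotientGroup.mk β) X.cls y ↔
      ∃ Y : LieExt 𝕜 G N, Y.cls = y ∧ Y.HasFactorSystem S (fun p => ω p * (β.1 p : N)) := by
  refine ⟨?_, fun ⟨Y, hy, hY⟩ => ⟨ω, β, X, Y, rfl, rfl, hy, hX, hY⟩⟩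
  rintro ⟨ω', β', X', Y, hβ, hX', hy, hω', hY⟩
  refine ⟨Y, hy, ?_⟩
  obtain ⟨z, hz, rfl⟩ := hX.exists_d1 (hω'.of_equivalent (LieExt.cls_eq_cls_iff.1 hX'))
  obtain ⟨z', hz', hββ'⟩ := H2ssZ.mk_eq_mk_iff.1 hβ
  have h := hY.mul_d1 (mul_mem (inv_mem hz) hz')
  have cochain_eq (p : G × G) :
      ω p * d1 S z p * β'.1 p * d1 S (z⁻¹ * z') p = ω p * (β.1 p : N) := by
    have h_center : d1 S z p * β'.1 p * d1 S (z⁻¹ * z') p = β.1 p := by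
      simp only [hββ', map_mul, map_inv, Pi.mul_apply, Pi.inv_apply]
      rw [mul_comm (d1 S z p), mul_assoc, mul_inv_cancel_left]
    rw [← h_center]
    simp only [Subgroup.coe_mul, mul_assoc]
  simpa only [cochain_eq] using h

theorem ExtAct.unique {c : H2ssZ 𝕜 S} {x y y' : LieExtClass 𝕜 G N} (h : ExtAct S c x y)
    (h' : ExtAct S c x y') : y = y' := by
  obtain ⟨ω, β, X, Y, rfl, rfl, rfl, hX, hY⟩ := h
  obtain ⟨Y', rfl, hY'⟩ := hX.extAct_mk_iff.1 h'
  exact LieExt.cls_eq_cls_iff.2 (hY.equivalent hY')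

variable [LCLieGroup 𝕜 G]

theorem LieExt.hasFactorSystem_semidirect (hS : IsSmoothAction 𝕜 S) :
    (LieExt.semidirect S hS).HasFactorSystem S 1 := by
  refine LieExt.hasFactorSystem_iff.2 ⟨fun g => ((1 : N), g),
    ⟨rfl, ((smooth_const 1).prodMk smooth_id).near 1⟩, fun _ => rfl, fun g n => ?_, fun g g' => ?_⟩
  · refine Prod.ext ?_ ((mul_one g).trans (one_mul g).symm)
    change 1 * S g n = S g n * S 1 1
    simp
  · refine Prod.ext ?_ (one_mul (g * g')).symm
    change 1 * S g 1 = 1 * S 1 1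
    simp

theorem isSmoothAction_twistedHom (hS : IsSmoothAction 𝕜 S) (f : Z1sCentral 𝕜 S) :
    IsSmoothAction 𝕜 (twistedHom S f.2.2) := by
  refine isSmoothAction_of_smoothNear_one (fun g => smooth_of_near fun n => ?_) fun n => ?_
  · exact (((smooth_const (f.1 g)).near n).mul (hS.smoothNear_apply ((smooth_const g).near n)
      (smooth_id.near n))).mul ((smooth_const (f.1 g)⁻¹).near n)
  · have h : SmoothNear 𝕜 (fun p : G × N => f.1 p.1) (1, n) :=
      f.2.1.2.comp_of_eq (smooth_fst.near _) rfl
    exact (h.mul (hS.near _)).mul h.inv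

theorem LieExt.exists_hasFactorSystem_dS_inv (hS : IsSmoothAction 𝕜 S) (f : Z1sCentral 𝕜 S) :
    ∃ X : LieExt 𝕜 G N, X.HasFactorSystem S (dS S f.1)⁻¹ := by
  refine ⟨LieExt.semidirect _ (isSmoothAction_twistedHom hS f), ?_⟩
  rw [← LieExt.hasFactorSystem_twist_iff f.2.1, (twistCochain_eq_one_iff S f.2.2).2 rfl]
  exact LieExt.hasFactorSystem_semidirect (isSmoothAction_twistedHom hS f)

theorem LieExt.HasFactorSystem.split_iff_exists_dS_inv (hX : X.HasFactorSystem S ω) :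
    X.Split ↔ ∃ f : Z1sCentral 𝕜 S, ω = (dS S f.1)⁻¹ := by
  rw [hX.split_iff]
  constructor
  · rintro ⟨f, hf, hω⟩
    obtain ⟨σ, hσ⟩ := LieExt.hasFactorSystem_iff.1 (hω ▸ hX.twist hf)
    have dS_central (p : G × G) : dS S f p ∈ Subgroup.center N := by
      refine (twistAction_mul_iff S).1 ((hσ.action_mul p.1 p.2).trans ?_)
      rw [Pi.one_apply, map_one, one_mul]
    exact ⟨⟨f, hf, dS_central⟩, (twistCochain_eq_one_iff S dS_central).1 hω⟩
  · rintro ⟨f, hω⟩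
    exact ⟨f.1, f.2.1, (twistCochain_eq_one_iff S f.2.2).2 hω⟩

theorem mem_ExtKernelSplit_iff {y : LieExtClass 𝕜 G N} :
    y ∈ ExtKernelSplit 𝕜 S ↔ ∃ f : Z1sCentral 𝕜 S, ∃ X : LieExt 𝕜 G N, X.cls = y ∧
      X.HasFactorSystem S (dS S f.1)⁻¹ := by
  constructor
  · rintro ⟨hy, Y, rfl, hY⟩
    obtain ⟨X, hXY, ω, hX⟩ := mem_ExtKernel_iff.1 hy
    obtain ⟨f, rfl⟩ := hX.split_iff_exists_dS_inv.1
      (hY.of_equivalent (LieExt.cls_eq_cls_iff.1 hXY.symm))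
    exact ⟨f, X, hXY, hX⟩
  · rintro ⟨f, X, rfl, hX⟩
    exact ⟨mem_ExtKernel_iff.2 ⟨X, rfl, _, hX⟩, X, rfl, hX.split_iff_exists_dS_inv.2 ⟨f, rfl⟩⟩

theorem extAct_inv_mk_centralCocycle_iff (hS : IsSmoothAction 𝕜 S) {f : Z1sCentral 𝕜 S}
    {y : LieExtClass 𝕜 G N} :
    ExtAct S (QuotientGroup.mk (centralCocycle hS f))⁻¹ (LieExt.semidirect S hS).cls y ↔
      ∃ Y : LieExt 𝕜 G N, Y.cls = y ∧ Y.HasFactorSystem S (dS S f.1)⁻¹ := by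
  rw [← QuotientGroup.mk_inv, (LieExt.hasFactorSystem_semidirect hS).extAct_mk_iff]
  simp only [Pi.one_apply, one_mul]
  rfl

variable [LCManifold 𝕜 (Subgroup.center N)] [LCLieGroup 𝕜 (Subgroup.center N)]
variable [LCManifold 𝕜 (N ⧸ Subgroup.center N)]

theorem existsUnique_extAct_inv (hZ : IsSplitLieSubgroup 𝕜 (Subgroup.center N))
    (hS : IsSmoothAction 𝕜 S) {c : H2ssZ 𝕜 S} (hc : c ∈ range (connectingMap hZ hS)) :
    ∃! y, ExtAct S c⁻¹ (LieExt.semidirect S hS).cls y := by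
  rw [range_connectingMap] at hc
  obtain ⟨f, rfl⟩ := hc
  obtain ⟨X, hX⟩ := LieExt.exists_hasFactorSystem_dS_inv hS f
  exact existsUnique_of_exists_of_unique
    ⟨X.cls, (extAct_inv_mk_centralCocycle_iff hS).2 ⟨X, rfl, hX⟩⟩ fun _ _ => ExtAct.unique

theorem extKernelSplit_eq (hZ : IsSplitLieSubgroup 𝕜 (Subgroup.center N))
    (hS : IsSmoothAction 𝕜 S) :
    ExtKernelSplit 𝕜 S = {y | ∃ c ∈ range (connectingMap hZ hS),
      ExtAct S c⁻¹ (LieExt.semidirect S hS).cls y} := by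
  ext y
  simp only [mem_ExtKernelSplit_iff, mem_ofPred_eq, range_connectingMap, exists_range_iff,
    extAct_inv_mk_centralCocycle_iff]

end ExtensionsWithKernel

theorem mainTheorem9 {𝕜 : Type*} [RCLike 𝕜]
    {G : Type u} [TopologicalSpace G] [Group G] [LCManifold 𝕜 G] [LCLieGroup 𝕜 G]
    {N : Type v} [TopologicalSpace N] [Group N] [LCManifold 𝕜 N] [LCLieGroup 𝕜 N]
    [LCManifold 𝕜 (Subgroup.center N)] [LCLieGroup 𝕜 (Subgroup.center N)]
    [LCManifold 𝕜 (N ⧸ Subgroup.center N)]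
    (hZ : IsSplitLieSubgroup 𝕜 (Subgroup.center N))
    (S : G →* MulAut N) (hS : Smooth 𝕜 (fun p : G × N => S p.1 p.2)) :
    -- `N_ad = N / Z(N)` is a Lie group on which `G` acts smoothly
    LCLieGroup 𝕜 (N ⧸ Subgroup.center N) ∧
    Smooth 𝕜 (fun p : G × (N ⧸ Subgroup.center N) => adAut N (S p.1) p.2) ∧
    ∃ (i₀ : fixedPts ((centerAut N).comp S) →* fixedPts S)
      (q₀ : fixedPts S →* fixedPts ((adAut N).comp S))
      (δ₀ : fixedPts ((adAut N).comp S) →* H1sZ 𝕜 S)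
      (i₁ : H1sZ 𝕜 S → H1s 𝕜 S)
      (q₁ : H1s 𝕜 S → H1s 𝕜 ((adAut N).comp S))
      (δ : H1s 𝕜 ((adAut N).comp S) → H2ssZ 𝕜 S),
      -- description of the maps
      (∀ z, (i₀ z : N) = ((z : Subgroup.center N) : N)) ∧
      (∀ n, (q₀ n : N ⧸ Subgroup.center N) = QuotientGroup.mk (n : N)) ∧
      (∀ (x : fixedPts ((adAut N).comp S)) (n : N), QuotientGroup.mk n = x.1 →
        ∃ c : Z1sZ 𝕜 S, (∀ g, (c.1 g : N) = n⁻¹ * S g n) ∧ δ₀ x = QuotientGroup.mk c) ∧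
      (∀ c : Z1sZ 𝕜 S, ∃ f : Z1s 𝕜 S, (∀ g, f.1 g = (c.1 g : N)) ∧
        i₁ (QuotientGroup.mk c) = H1s.mk 𝕜 S f) ∧
      (∀ f : Z1s 𝕜 S, ∃ f' : Z1s 𝕜 ((adAut N).comp S),
        (∀ g, f'.1 g = QuotientGroup.mk (f.1 g)) ∧
        q₁ (H1s.mk 𝕜 S f) = H1s.mk 𝕜 ((adAut N).comp S) f') ∧
      (∀ f : Z1s 𝕜 ((adAut N).comp S),
        (∃ fh ∈ Z1sCentral 𝕜 S, ∀ g, QuotientGroup.mk (fh g) = f.1 g) ∧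
        ∀ fh ∈ Z1sCentral 𝕜 S, (∀ g, QuotientGroup.mk (fh g) = f.1 g) →
          ∃ c : Z2ssZ 𝕜 S, (∀ p, (c.1 p : N) = dS S fh p) ∧
            δ (H1s.mk 𝕜 ((adAut N).comp S) f) = QuotientGroup.mk c) ∧
      -- exactness
      Function.Injective i₀ ∧
      q₀.ker = i₀.range ∧
      δ₀.ker = q₀.range ∧
      (∀ c, i₁ c = H1s.base 𝕜 S ↔ c ∈ δ₀.range) ∧
      (∀ x, q₁ x = H1s.base 𝕜 ((adAut N).comp S) ↔ x ∈ Set.range i₁) ∧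
      (∀ y, δ y = 1 ↔ y ∈ Set.range q₁) ∧
      -- the split extensions: `Ext(G, N)_{[S], split} = (- im δ).[N ⋊_S G]`
      (∀ c ∈ Set.range δ, ∃! y, ExtAct S c⁻¹ (LieExt.semidirect S hS).cls y) ∧
      ExtKernelSplit 𝕜 S =
        {y | ∃ c ∈ Set.range δ, ExtAct S c⁻¹ (LieExt.semidirect S hS).cls y} := by
  refine ⟨IsLieExtension.lcLieGroup_base hZ, IsSmoothAction.ad hZ hS, fixedIncl S, fixedProj S,
    connectingHom hS, H1sZ.toH1s, H1s.toAd hZ, connectingMap hZ hS, fun _ => rfl, fun _ => rfl,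
    ?connectingHom_apply, fun c => ⟨⟨_, mem_Z1sZ_iff.1 c.2⟩, fun _ => rfl, rfl⟩,
    fun f => ⟨adCocycle hZ ⟨f.1, Z1s_subset_Z1sCentral f.2⟩, fun _ => rfl, rfl⟩,
    fun f => ⟨?exists_lift, ?connectingMap_apply⟩, fixedIncl_injective S, fixedProj_ker S,
    connectingHom_ker hS, H1sZ.toH1s_eq_base_iff hS, H1s.toAd_eq_base_iff hZ hS,
    connectingMap_eq_one_iff hZ hS, fun _ => existsUnique_extAct_inv hZ hS,
    extKernelSplit_eq hZ hS⟩
  case connectingHom_apply =>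
    rintro ⟨_, hn⟩ n rfl
    exact ⟨coboundaryHom hS ⟨n, hn⟩, fun _ => rfl, connectingHom_modCenter hS ⟨n, hn⟩⟩
  case exists_lift =>
    obtain ⟨fh, rfl⟩ := adCocycle_surjective hZ f
    exact ⟨fh.1, fh.2, fun _ => rfl⟩
  case connectingMap_apply =>
    intro fh hfh h
    obtain rfl : adCocycle hZ ⟨fh, hfh⟩ = f := Subtype.ext (funext h)
    exact ⟨centralCocycle hS ⟨fh, hfh⟩, fun _ => rfl, connectingMap_adClass hZ hS ⟨fh, hfh⟩⟩
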